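/- Let $d\ge 1$, write points of $\mathbb{R}^d=\mathbb{R}\times\mathbb{R}^{d-1}$ as $x=(x_1,x')$, and let $\psi:\mathbb{R}^{d-1}\to\mathbb{R}$ satisfy: there is $\ell>0$ with $\psi(x')>\ell$ for all $x'\in\mathbb{R}^{d-1}$, and there is $L\ge 0$ with $|\psi(x')-\psi(y')|\le L|x'-y'|$ for all $x',y'\in\mathbb{R}^{d-1}$. Let $H_1$ be the regular shear flow, that is, the closure in $L^2(\mathbb{R}^d)=L^2(\mathbb{R}^d;\mathbb{C})$ of the operator $-i\,\psi(x')\,\frac{\partial}{\partial x_1}$ with domain $C_0^\infty(\mathbb{R}^d)$. Then $H_1$ is self-adjoint, and its spectral measure is absolutely continuous with respect to the Lebesgue measure. The latter means the following. $H_1$ has a spectral family $\{E(\lambda)\}_{\lambda\in\mathbb{R}}$: for every $\lambda\in\mathbb{R}$, $E(\lambda)$ is the orthogonal projection onto the largest closed subspace $M\subset L^2(\mathbb{R}^d)$ such that the orthogonal projection $P$ onto $M$ satisfies $Pg\in D(H_1)$ and $H_1Pg=PH_1g$ for all $g\in D(H_1)$, and such that $(H_1u,u)\le\lambda(u,u)$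 for all $u\in M\cap D(H_1)$. For all $f,g\in L^2(\mathbb{R}^d)$ there is a complex Borel measure $\mu_{f,g}$ on $\mathbb{R}$ (the spectral measure) with $\mu_{f,g}((-\infty,\lambda])=(E(\lambda)f,g)_{L^2(\mathbb{R}^d)}$ for all $\lambda\in\mathbb{R}$, and $\mu_{f,g}$ is absolutely continuous with respect to the Lebesgue measure on $\mathbb{R}$. -/

import Mathlib

open MeasureTheory Set
open scoped ContDiff NNReal InnerProductSpace

/-- Euclidean space `ℝ^d` with `d = n + 1`, whose points are written `(x₁, x')` with `x₁ : ℝ` and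
`x' = (x₂, …, x_d) : ℝ^(d-1)`. Its `volume` is the Lebesgue measure. -/
abbrev ShearSpace (n : ℕ) : Type := ℝ × EuclideanSpace ℝ (Fin n)

/-- The complex Hilbert space `L²(ℝ^d)`, `d = n + 1`. -/
abbrev ShearL2 (n : ℕ) : Type := Lp ℂ 2 (volume : Measure (ShearSpace n))

/-- `ψ` defines a regular shear flow: it is bounded below by a positive constant and is globally
Lipschitz. -/
structure IsRegularShear {n : ℕ} (ψ : EuclideanSpace ℝ (Fin n) → ℝ) : Prop where
  exists_lower_bound : ∃ l : ℝ, 0 < l ∧ ∀ x', l < ψ x'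
  exists_lipschitz : ∃ L : ℝ≥0, LipschitzWith L ψ

/-- The test functions `C_0^∞(ℝ^d)`. -/
def IsTestFn {n : ℕ} (f : ShearSpace n → ℂ) : Prop :=
  ContDiff ℝ ∞ f ∧ HasCompactSupport f

/-- The pointwise action of `-i ψ(x') ∂/∂x₁` on a function. -/
noncomputable def shearAction {n : ℕ} (ψ : EuclideanSpace ℝ (Fin n) → ℝ)
    (f : ShearSpace n → ℂ) (x : ShearSpace n) : ℂ :=
  -Complex.I * (ψ x.2 : ℂ) * deriv (fun s : ℝ => f (s, x.2)) x.1

theorem IsTestFn.differentiable_slice {n : ℕ} {f : ShearSpace n → ℂ} (hf : IsTestFn f)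
    (y : EuclideanSpace ℝ (Fin n)) : Differentiable ℝ (fun s : ℝ => f (s, y)) :=
  (hf.1.differentiable (by simp)).comp (differentiable_id.prodMk (differentiable_const y))

/-- The graph in `L²(ℝ^d) × L²(ℝ^d)` of `-i ψ(x') ∂/∂x₁` acting on `C_0^∞(ℝ^d)`. -/
def shearGraph {n : ℕ} (ψ : EuclideanSpace ℝ (Fin n) → ℝ) :
    Submodule ℂ (ShearL2 n × ShearL2 n) where
  carrier := {p | ∃ f : ShearSpace n → ℂ, IsTestFn f ∧
    p.1 =ᵐ[volume] f ∧ p.2 =ᵐ[volume] shearAction ψ f}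
  zero_mem' := by
    refine ⟨0, ⟨contDiff_const, HasCompactSupport.zero⟩, Lp.coeFn_zero _ _ _, ?_⟩
    refine (Lp.coeFn_zero _ _ _).trans (Filter.Eventually.of_forall fun x => ?_)
    simp [shearAction]
  add_mem' := by
    rintro p q ⟨f, hf, hpf, hpf'⟩ ⟨g, hg, hqg, hqg'⟩
    refine ⟨f + g, ⟨hf.1.add hg.1, hf.2.add hg.2⟩, ?_, ?_⟩
    · exact (Lp.coeFn_add _ _).trans (hpf.add hqg)
    · refine (Lp.coeFn_add _ _).trans ((hpf'.add hqg').trans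
        (Filter.Eventually.of_forall fun x => ?_))
      have h := deriv_fun_add (hf.differentiable_slice x.2 x.1) (hg.differentiable_slice x.2 x.1)
      simp only [shearAction, Pi.add_apply, h]
      ring
  smul_mem' := by
    rintro c p ⟨f, hf, hpf, hpf'⟩
    refine ⟨c • f, ⟨contDiff_const.smul hf.1, hf.2.smul_left⟩, ?_, ?_⟩
    · exact (Lp.coeFn_smul c _).trans (hpf.const_smul c)
    · refine (Lp.coeFn_smul c _).trans ((hpf'.const_smul c).trans
        (Filter.Eventually.of_forall fun x => ?_))
      have h := deriv_fun_const_smul c (hf.differentiable_slice x.2 x.1)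
      simp only [smul_eq_mul] at h
      simp only [shearAction, Pi.smul_apply, smul_eq_mul, h]
      ring

/-- The graph above is single-valued, so it is the graph of an operator. -/
theorem shearGraph_single_valued {n : ℕ} (ψ : EuclideanSpace ℝ (Fin n) → ℝ) :
    ∀ p ∈ shearGraph ψ, p.1 = 0 → p.2 = 0 := by
  rintro p ⟨f, hf, hpf, hpf'⟩ h0
  have hf0 : f = 0 := by
    refine Continuous.ae_eq_iff_eq (volume : Measure (ShearSpace n)) hf.1.continuous
      continuous_const |>.1 (hpf.symm.trans ?_)
    rw [h0]
    exact Lp.coeFn_zero _ _ _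
  refine Lp.ext (hpf'.trans (Filter.EventuallyEq.trans ?_ (Lp.coeFn_zero _ _ _).symm))
  refine Filter.Eventually.of_forall fun x => ?_
  simp [shearAction, hf0]

/-- The operator `-i ψ(x') ∂/∂x₁` in `L²(ℝ^d)` with domain `C_0^∞(ℝ^d)`. -/
noncomputable def shearMinimal {n : ℕ} (ψ : EuclideanSpace ℝ (Fin n) → ℝ) :
    ShearL2 n →ₗ.[ℂ] ShearL2 n :=
  (shearGraph ψ).toLinearPMap

theorem shearMinimal_graph {n : ℕ} (ψ : EuclideanSpace ℝ (Fin n) → ℝ) :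
    (shearMinimal ψ).graph = shearGraph ψ :=
  Submodule.toLinearPMap_graph_eq _ (shearGraph_single_valued ψ)

/-- The shear flow operator `H₁ = -i ψ(x') ∂/∂x₁` in `L²(ℝ^d)`: the closure of its restriction to
`C_0^∞(ℝ^d)`. -/
noncomputable def shearFlow {n : ℕ} (ψ : EuclideanSpace ℝ (Fin n) → ℝ) :
    ShearL2 n →ₗ.[ℂ] ShearL2 n :=
  (shearMinimal ψ).closure

section SpectralFamily

variable {V : Type*} [NormedAddCommGroup V] [InnerProductSpace ℂ V] [CompleteSpace V]

/-- `P` is the orthogonal projection onto a closed subspace `M` which reduces `A`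
(`P g ∈ D(A)` and `A P g = P A g` for all `g ∈ D(A)`) and on which `(A u, u) ≤ r (u, u)` for every
`u ∈ M ∩ D(A)`. Closed subspaces are represented by their orthogonal projections. -/
structure IsReducingBelow (A : V →ₗ.[ℂ] V) (r : ℝ) (P : V →L[ℂ] V) : Prop where
  isStarProjection : IsStarProjection P
  reduces : ∀ g : A.domain, ∃ h : P g ∈ A.domain, A ⟨P g, h⟩ = P (A g)
  form_le : ∀ u : A.domain, (u : V) ∈ P.range →
    (inner ℂ (u : V) (A u)).re ≤ r * (inner ℂ (u : V) (u : V)).re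

/-- `E` is the spectral family (resolution of the identity) of `A`: for every real `r`, `E r` is the
orthogonal projection onto the largest closed subspace that reduces `A` and on which
`(A u, u) ≤ r (u, u)`. -/
def IsSpectralFamily (A : V →ₗ.[ℂ] V) (E : ℝ → V →L[ℂ] V) : Prop :=
  ∀ r : ℝ, IsReducingBelow A r (E r) ∧
    ∀ P : V →L[ℂ] V, IsReducingBelow A r P → P.range ≤ (E r).range

/-- `μ` is the spectral measure of the spectral family `E` at `f, g`: the complex Borel measure on
`ℝ` with distribution function `r ↦ (E(r) f, g)`. The scalar product of `f` and `g`, linear in `f`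
and antilinear in `g`, is `inner ℂ g f`. -/
def IsSpectralMeasure (E : ℝ → V →L[ℂ] V) (f g : V) (μ : ComplexMeasure ℝ) : Prop :=
  ∀ r : ℝ, μ (Iic r) = inner ℂ g (E r f)

end SpectralFamily

/-! On each line parallel to the x₁-axis, ψ is constant and the operator is a multiple of -i d/dx₁.
The Fourier transform in x₁ (`shearFourier`) therefore turns it into multiplication by the real
symbol m = 2πψ(x')ξ₁. All claims can be read off this model once the closure from test functions is
known to be the maximal multiplication operator (`isMultiplicationModel_shearFlow`).

That identification is a core argument. Since |m + i| dominates both 1 and |m|, the graph norm is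
controlled by A + i, and it suffices that A + i has dense range on the closure
(`topologicalClosure_eq_multiplicationGraph`). A vector h orthogonal to this range is tested against
functions with transform α(ξ₁)β(x'), which gives (m - i)ĥ = 0, so h = 0. Such functions are Schwartz
but in general not compactly supported in x₁; `tensor_mem_closure` reaches them by cutoffs.

In the model, 1/(m - z) is bounded for nonreal z, which gives self-adjointness, and E(λ) is the
indicator of {m ≤ λ}. The delicate point is maximality: a competing reducing subspace is not assumed
to come from a subset of the space. The form bound limits the resolvent on that subspace, and
iterated resolvents force supports into {m ≤ λ} (`ae_eq_zero_of_lt`). The spectral measure is the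
image under m of the density f̂ · conj ĝ. It is absolutely continuous because m is linear in ξ₁ with
nonzero slope. -/

/-! ### Multiplication operators: resolvents and self-adjointness. -/

section MultiplicationOperator

/-- Multiplication by an essentially bounded function, as an operator on `L²`. -/
noncomputable def mulBounded {X : Type*} [MeasurableSpace X] {ρ : Measure X} {φ : X → ℂ}
    (hφ : MemLp φ ⊤ ρ) : Lp ℂ 2 ρ →L[ℂ] Lp ℂ 2 ρ :=
  (ContinuousLinearMap.mul ℂ ℂ).holderL ρ ⊤ 2 2 (hφ.toLp φ)

theorem coeFn_mulBounded {X : Type*} [MeasurableSpace X] {ρ : Measure X} {φ : X → ℂ}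
    (hφ : MemLp φ ⊤ ρ) (u : Lp ℂ 2 ρ) :
    mulBounded hφ u =ᵐ[ρ] fun x => φ x * u x := by
  refine ((ContinuousLinearMap.mul ℂ ℂ).coeFn_holder (r := 2) (hφ.toLp φ) u).trans ?_
  filter_upwards [hφ.coeFn_toLp] with x hx
  simp [hx]

variable {V X : Type*} [NormedAddCommGroup V] [InnerProductSpace ℂ V]
  [MeasurableSpace X] {ρ : Measure X}

/-- The unitary map `W` carries `A` to the maximal operator of multiplication by the real function
`m`. -/
def IsMultiplicationModel (A : V →ₗ.[ℂ] V) (W : V ≃ₗᵢ[ℂ] Lp ℂ 2 ρ) (m : X → ℝ) : Prop :=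
  ∀ p : V × V, p ∈ A.graph ↔ W p.2 =ᵐ[ρ] fun x => (m x : ℂ) * W p.1 x

/-- A symmetric operator `A` for which `A + i` and `A - i` are onto is self-adjoint. -/
theorem isSelfAdjoint_of_surjective [CompleteSpace V] {A : V →ₗ.[ℂ] V}
    (hsym : ∀ u v : A.domain, inner ℂ (A u) (v : V) = inner ℂ (u : V) (A v))
    (hsurj : ∀ z : ℂ, z.im ≠ 0 → ∀ w : V, ∃ u : A.domain, A u - z • (u : V) = w) :
    IsSelfAdjoint A := by
  -- If h is orthogonal to the domain and (A - i)u = h, the imaginary part of 0 = (u, Au) - i‖u‖²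
  -- gives u = 0.
  have hdense : Dense (A.domain : Set V) := by
    rw [Submodule.dense_iff_topologicalClosure_eq_top,
      Submodule.topologicalClosure_eq_top_iff, Submodule.eq_bot_iff]
    intro h hh
    obtain ⟨u, hu⟩ := hsurj Complex.I (by simp) h
    have h0 : inner ℂ (u : V) h = 0 := hh u u.2
    rw [← hu, inner_sub_right, inner_smul_right] at h0
    have hreal : (inner ℂ (u : V) (A u)).im = 0 := by
      rw [← Complex.conj_eq_iff_im, inner_conj_symm, hsym]
    have h1 : ‖(u : V)‖ = 0 := by
      have := congrArg Complex.im h0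
      rw [inner_self_eq_norm_sq_to_K] at this
      simp [hreal] at this
      norm_cast at this
      simpa using this
    have h2 : u = 0 := by simpa using h1
    rw [← hu, h2]
    simp
  rw [LinearPMap.isSelfAdjoint_def]
  refine LinearPMap.eq_of_eq_graph ?_
  rw [LinearPMap.adjoint_graph_eq_graph_adjoint hdense]
  ext ⟨u, v⟩
  rw [Submodule.mem_adjoint_iff]
  -- The kernel of A* - i is trivial, being orthogonal to the range of A + i.
  have key : ∀ w : V, (∀ c : A.domain, inner ℂ (A c) w = inner ℂ (c : V) (Complex.I • w)) →
      w = 0 := by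
    intro w hw
    obtain ⟨c, hc⟩ := hsurj (-Complex.I) (by simp) w
    have : inner ℂ w w = 0 := by
      conv_lhs => enter [2]; rw [← hc]
      rw [inner_sub_left, hw, inner_smul_right, inner_smul_left]
      simp
    simpa using this
  constructor
  · intro h
    -- For (u, v) in the graph of A*, solving (A - i)a = v - iu puts u - a in the kernel of A* - i.
    obtain ⟨a, ha⟩ := hsurj Complex.I (by simp) (v - Complex.I • u)
    have hz : u - a = 0 := by
      refine key _ fun c => ?_
      have h1 := h c (A c) (A.mem_graph c)
      have h2 : Complex.I • (u - (a : V)) = v - A a := by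
        rw [smul_sub, sub_eq_sub_iff_add_eq_add]
        rw [sub_eq_sub_iff_add_eq_add] at ha
        rw [add_comm, ha, add_comm]
      rw [h2, inner_sub_right, inner_sub_right, hsym c a, sub_eq_zero.1 h1]
    have hua : u = a := sub_eq_zero.1 hz
    have hva : v = A a := by
      rw [hua] at ha
      exact (sub_left_injective ha).symm
    rw [hua, hva]
    exact A.mem_graph a
  · intro h a b hab
    obtain ⟨x, hx, hx'⟩ := (LinearPMap.mem_graph_iff _).1 h
    obtain ⟨y, hy, hy'⟩ := (LinearPMap.mem_graph_iff _).1 hab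
    simp only at hx hx' hy hy' ⊢
    rw [← hx, ← hx', ← hy, ← hy', hsym, sub_self]

namespace IsMultiplicationModel

variable {A : V →ₗ.[ℂ] V} {W : V ≃ₗᵢ[ℂ] Lp ℂ 2 ρ} {m : X → ℝ}

theorem apply_ae (hA : IsMultiplicationModel A W m) (u : A.domain) :
    W (A u) =ᵐ[ρ] fun x => (m x : ℂ) * W (u : V) x :=
  (hA _).1 (A.mem_graph u)

theorem exists_apply_eq (hA : IsMultiplicationModel A W m) {u v : V}
    (h : W v =ᵐ[ρ] fun x => (m x : ℂ) * W u x) : ∃ hu : u ∈ A.domain, A ⟨u, hu⟩ = v := by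
  obtain ⟨y, hy, hy'⟩ := (LinearPMap.mem_graph_iff _).1 ((hA (u, v)).2 h)
  simp only at hy hy'
  subst hy
  exact ⟨y.2, hy'⟩

theorem symmetric (hA : IsMultiplicationModel A W m) (u v : A.domain) :
    inner ℂ (A u) (v : V) = inner ℂ (u : V) (A v) := by
  rw [← W.inner_map_map, ← W.inner_map_map (u : V), L2.inner_def, L2.inner_def]
  refine integral_congr_ae ?_
  filter_upwards [hA.apply_ae u, hA.apply_ae v] with x hu hv
  rw [hu, hv]
  simp only [RCLike.inner_apply, map_mul, Complex.conj_ofReal]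
  ring

theorem sub_ne_zero_of_im {z : ℂ} (hz : z.im ≠ 0) (t : ℝ) : (t : ℂ) - z ≠ 0 := by
  intro h
  have := congrArg Complex.im h
  simp at this
  exact hz this

/-- Divide by m - z, which is bounded below in modulus by |Im z|. Maximality of the domain does the
rest: if û = ŵ/(m - z), then mû = ŵ + zû is again in L². -/
theorem exists_resolvent (hA : IsMultiplicationModel A W m) (hm : Measurable m) {z : ℂ}
    (hz : z.im ≠ 0) (w : V) : ∃ u : A.domain, A u - z • (u : V) = w := by
  have hb : MemLp (fun x => ((m x : ℂ) - z)⁻¹) ⊤ ρ := by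
    refine memLp_top_of_bound ?_ |z.im|⁻¹ (Filter.Eventually.of_forall fun x => ?_)
    · exact Measurable.aestronglyMeasurable (by fun_prop)
    · rw [norm_inv]
      refine inv_anti₀ (abs_pos.2 hz) ?_
      simpa using Complex.abs_im_le_norm ((m x : ℂ) - z)
  set u : V := W.symm (mulBounded hb (W w)) with hu
  have hWu : W u =ᵐ[ρ] fun x => ((m x : ℂ) - z)⁻¹ * W w x := by
    rw [hu, W.apply_symm_apply]
    exact coeFn_mulBounded hb _
  obtain ⟨h, h'⟩ := hA.exists_apply_eq (u := u) (v := w + z • u) (by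
    rw [map_add, map_smul]
    filter_upwards [Lp.coeFn_add (W w) (z • W u), Lp.coeFn_smul z (W u), hWu] with x h1 h2 h3
    rw [h1, Pi.add_apply, h2, Pi.smul_apply, h3, smul_eq_mul]
    field_simp [sub_ne_zero_of_im hz (m x)]
    ring)
  exact ⟨⟨u, h⟩, by rw [h']; simp⟩

theorem isSelfAdjoint [CompleteSpace V] (hA : IsMultiplicationModel A W m) (hm : Measurable m) :
    IsSelfAdjoint A :=
  isSelfAdjoint_of_surjective hA.symmetric fun _ hz => hA.exists_resolvent hm hz

theorem eq_of_sub_smul_eq (hA : IsMultiplicationModel A W m) {z : ℂ} (hz : z.im ≠ 0)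
    {u v : A.domain} (h : A u - z • (u : V) = A v - z • (v : V)) : (u : V) = v := by
  have h0 : A (u - v) = z • ((u - v : A.domain) : V) := by
    rw [LinearPMap.map_sub, AddSubgroupClass.coe_sub, smul_sub, ← sub_eq_zero]
    rw [← sub_eq_zero] at h
    rw [← h]
    abel
  have h1 := hA.apply_ae (u - v)
  rw [h0, map_smul] at h1
  have h2 : W ((u - v : A.domain) : V) = 0 := by
    refine Lp.ext ?_
    filter_upwards [h1, Lp.coeFn_smul z (W ((u - v : A.domain) : V)), Lp.coeFn_zero ℂ 2 ρ]
      with x hx hx' hx0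
    rw [hx0, Pi.zero_apply]
    rw [hx', Pi.smul_apply, smul_eq_mul] at hx
    have : ((m x : ℂ) - z) * W ((u - v : A.domain) : V) x = 0 := by rw [sub_mul, hx, sub_self]
    exact (mul_eq_zero.1 this).resolve_left (sub_ne_zero_of_im hz _)
  rw [map_eq_zero_iff _ W.injective, AddSubgroupClass.coe_sub, sub_eq_zero] at h2
  exact h2

end IsMultiplicationModel

end MultiplicationOperator

/-! ### The spectral family and spectral measures of a multiplication operator. -/

section SpectralFamilyOfModel

variable {V X : Type*} [NormedAddCommGroup V] [InnerProductSpace ℂ V]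
  [MeasurableSpace X] {ρ : Measure X}

theorem IsStarProjection.apply_apply [CompleteSpace V] {P : V →L[ℂ] V} (hP : IsStarProjection P) (u : V) :
    P (P u) = P u :=
  congrArg (fun Q : V →L[ℂ] V => Q u) hP.isIdempotentElem

theorem IsStarProjection.mem_range_iff [CompleteSpace V] {P : V →L[ℂ] V} (hP : IsStarProjection P) {u : V} :
    u ∈ P.range ↔ P u = u := by
  constructor
  · rintro ⟨w, rfl⟩
    exact hP.apply_apply w
  · intro h
    exact ⟨u, h⟩

theorem re_mul_inner_self {V : Type*} [NormedAddCommGroup V] [InnerProductSpace ℂ V] (z : ℂ)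
    (w : V) : (z * inner ℂ w w).re = z.re * ‖w‖ ^ 2 := by
  rw [inner_self_eq_norm_sq_to_K]
  change (z * ((‖w‖ : ℝ) : ℂ) ^ 2).re = _
  rw [← Complex.ofReal_pow, Complex.re_mul_ofReal]

theorem memLp_top_indicator_one {S : Set X} (hS : MeasurableSet S) :
    MemLp (S.indicator fun _ => (1 : ℂ)) ⊤ ρ := by
  refine memLp_top_of_bound ?_ 1 (Filter.Eventually.of_forall fun x => ?_)
  · exact (measurable_const.indicator hS).aestronglyMeasurable
  · by_cases h : x ∈ S <;> simp [h]

namespace IsMultiplicationModel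

variable [CompleteSpace V] {A : V →ₗ.[ℂ] V} {W : V ≃ₗᵢ[ℂ] Lp ℂ 2 ρ} {m : X → ℝ}

/-- The resolvent of `A` leaves the range of `P` invariant, and is bounded there by the inverse
distance to the upper bound of the form. -/
theorem exists_resolvent_mem_range (hA : IsMultiplicationModel A W m) (hm : Measurable m)
    {r : ℝ} {P : V →L[ℂ] V} (hP : IsReducingBelow A r P) {z : ℂ} (hz : z.im ≠ 0) {u : V}
    (hu : u ∈ P.range) :
    ∃ w : A.domain, (w : V) ∈ P.range ∧ A w - z • (w : V) = u ∧ (z.re - r) * ‖(w : V)‖ ≤ ‖u‖ := by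
  obtain ⟨w, hw⟩ := hA.exists_resolvent hm hz u
  -- P commutes with A and fixes u, so Pw solves the same resolvent equation as w; uniqueness gives
  -- Pw = w.
  have hwP : (w : V) ∈ P.range := by
    obtain ⟨h, h'⟩ := hP.reduces w
    have : (P w : V) = w := by
      refine hA.eq_of_sub_smul_eq hz (u := ⟨P w, h⟩) ?_
      rw [h', hw]
      simp only
      rw [← map_smul, ← map_sub, hw]
      exact hP.isStarProjection.mem_range_iff.1 hu
    exact hP.isStarProjection.mem_range_iff.2 this
  refine ⟨w, hwP, hw, ?_⟩
  rcases (norm_nonneg (w : V)).eq_or_lt with h0 | h0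
  · rw [← h0, mul_zero]
    exact norm_nonneg u
  have h1 := hP.form_le w hwP
  -- Substitute Aw = u + zw into the form bound Re(w, Aw) ≤ r‖w‖² and apply Cauchy–Schwarz.
  have h2 : (z.re - r) * ‖(w : V)‖ ^ 2 ≤ ‖(w : V)‖ * ‖u‖ := by
    have h3 : inner ℂ (w : V) (A w) = inner ℂ (w : V) u + z * inner ℂ (w : V) (w : V) := by
      rw [← hw, inner_sub_right, inner_smul_right]
      ring
    have h4 : -(‖(w : V)‖ * ‖u‖) ≤ (inner ℂ (w : V) u).re :=
      neg_le_of_abs_le ((Complex.abs_re_le_norm _).trans (norm_inner_le_norm _ _))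
    have h5 := re_mul_inner_self 1 (w : V)
    rw [one_mul, Complex.one_re, one_mul] at h5
    rw [h3, Complex.add_re, re_mul_inner_self, h5] at h1
    linarith
  nlinarith

/-- Here w = (A - z)⁻ᵏu; each resolvent stays in the range of P and gains a factor 1/(Re z - r). -/
theorem exists_iterated_resolvent (hA : IsMultiplicationModel A W m) (hm : Measurable m)
    {r : ℝ} {P : V →L[ℂ] V} (hP : IsReducingBelow A r P) {z : ℂ} (hz : z.im ≠ 0)
    (hr : r < z.re) {u : V} (hu : u ∈ P.range) (k : ℕ) :
    ∃ w : V, w ∈ P.range ∧ (z.re - r) ^ k * ‖w‖ ≤ ‖u‖ ∧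
      W u =ᵐ[ρ] fun x => ((m x : ℂ) - z) ^ k * W w x := by
  induction k with
  | zero => exact ⟨u, hu, by simp, by simp⟩
  | succ k ih =>
    obtain ⟨w, hw, hle, hae⟩ := ih
    obtain ⟨v, hv, hvw, hvle⟩ := hA.exists_resolvent_mem_range hm hP hz hw
    refine ⟨v, hv, ?_, ?_⟩
    · calc (z.re - r) ^ (k + 1) * ‖(v : V)‖ = (z.re - r) ^ k * ((z.re - r) * ‖(v : V)‖) := by ring
        _ ≤ (z.re - r) ^ k * ‖w‖ := by
          have := sub_pos.2 hr
          gcongr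
        _ ≤ ‖u‖ := hle
    · rw [← hvw, map_sub, map_smul] at hae
      filter_upwards [hae, hA.apply_ae v, Lp.coeFn_sub (W (A v)) (z • W (v : V)),
        Lp.coeFn_smul z (W (v : V))] with x h1 h2 h3 h4
      rw [h1, h3, Pi.sub_apply, h4, Pi.smul_apply, h2, smul_eq_mul]
      ring

/-- On {|m - z| ≤ c}, the k-th iterated resolvent w satisfies |Wu| ≤ cᵏ|Ww|, so the restriction of
Wu there has norm at most (c/(Re z - r))ᵏ‖u‖, which tends to 0. -/
theorem ae_eq_zero_of_norm_sub_le (hA : IsMultiplicationModel A W m) (hm : Measurable m)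
    {r : ℝ} {P : V →L[ℂ] V} (hP : IsReducingBelow A r P) {z : ℂ} (hz : z.im ≠ 0) {c : ℝ}
    (hc : 0 ≤ c) (hcr : c < z.re - r) {u : V} (hu : u ∈ P.range) :
    ∀ᵐ x ∂ρ, ‖(m x : ℂ) - z‖ ≤ c → W u x = 0 := by
  have hS : MeasurableSet {x | ‖(m x : ℂ) - z‖ ≤ c} := measurableSet_le (by fun_prop) (by fun_prop)
  set v := mulBounded (memLp_top_indicator_one (ρ := ρ) hS) (W u) with hv
  have hvae := coeFn_mulBounded (memLp_top_indicator_one (ρ := ρ) hS) (W u)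
  rw [← hv] at hvae
  have hpos : 0 < z.re - r := hc.trans_lt hcr
  have hle : ∀ k : ℕ, ‖v‖ ≤ (c / (z.re - r)) ^ k * ‖u‖ := by
    intro k
    obtain ⟨w, -, hw, hae⟩ := hA.exists_iterated_resolvent hm hP hz (by linarith) hu k
    have h1 : ‖v‖ ≤ c ^ k * ‖W w‖ := by
      refine Lp.norm_le_mul_norm_of_ae_le_mul ?_
      filter_upwards [hvae, hae] with x h1 h2
      rw [h1, h2]
      by_cases hx : ‖(m x : ℂ) - z‖ ≤ c
      · simp only [mem_ofPred_eq, hx, indicator_of_mem, one_mul, norm_mul, norm_pow]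
        gcongr
      · simp only [mem_ofPred_eq, hx, not_false_eq_true, indicator_of_notMem, zero_mul, norm_zero]
        positivity
    rw [W.norm_map] at h1
    rw [div_pow, div_mul_eq_mul_div, le_div_iff₀ (by positivity)]
    calc ‖v‖ * (z.re - r) ^ k ≤ c ^ k * ‖w‖ * (z.re - r) ^ k := by gcongr
      _ = c ^ k * ((z.re - r) ^ k * ‖w‖) := by ring
      _ ≤ c ^ k * ‖u‖ := by gcongr
  have hlim : Filter.Tendsto (fun k : ℕ => (c / (z.re - r)) ^ k * ‖u‖) Filter.atTop
      (nhds (0 * ‖u‖)) :=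
    (tendsto_pow_atTop_nhds_zero_of_lt_one (by positivity)
      ((div_lt_one hpos).2 hcr)).mul_const _
  have hv0 : v = 0 := by
    rw [zero_mul] at hlim
    exact norm_le_zero_iff.1 (ge_of_tendsto' hlim hle)
  rw [hv0] at hvae
  filter_upwards [hvae, Lp.coeFn_zero ℂ 2 ρ] with x h1 h2 hx
  rw [h2] at h1
  simpa [hx] using h1.symm

/-- Vectors in the range of `P` are supported on `{m ≤ r}`. -/
theorem ae_eq_zero_of_lt (hA : IsMultiplicationModel A W m) (hm : Measurable m)
    {r : ℝ} {P : V →L[ℂ] V} (hP : IsReducingBelow A r P) {u : V} (hu : u ∈ P.range) :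
    ∀ᵐ x ∂ρ, r < m x → W u x = 0 := by
  -- Rational parameters leave countably many null sets; the discs are centred at s + iε off the
  -- real axis, where the resolvent exists.
  have h : ∀ s ε c : ℚ, ∀ᵐ x ∂ρ, 0 < ε → 0 < c → (c : ℝ) < s - r →
      ‖(m x : ℂ) - ⟨s, ε⟩‖ ≤ c → W u x = 0 := by
    intro s ε c
    by_cases h1 : 0 < ε ∧ 0 < c ∧ (c : ℝ) < s - r
    · filter_upwards [hA.ae_eq_zero_of_norm_sub_le hm hP (z := ⟨s, ε⟩) (c := c)
        (by simpa using h1.1.ne') (by exact_mod_cast h1.2.1.le) h1.2.2 hu] with x hx _ _ _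
      exact hx
    · exact Filter.Eventually.of_forall fun x h2 h3 h4 => absurd ⟨h2, h3, h4⟩ h1
  simp_rw [← ae_all_iff] at h
  filter_upwards [h] with x hx hrx
  -- The choices give |m x - s| + ε < (m x - r)/2 < c < m x - r < s - r.
  obtain ⟨s, hs1, hs2⟩ := exists_rat_btwn (show m x < m x + (m x - r) / 4 by linarith)
  obtain ⟨ε, he1, he2⟩ := exists_rat_btwn (show (0 : ℝ) < (m x - r) / 4 by linarith)
  obtain ⟨c, hc1, hc2⟩ := exists_rat_btwn (show (m x - r) / 2 < m x - r by linarith)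
  refine hx s ε c (by exact_mod_cast he1) (by exact_mod_cast (by linarith : (0 : ℝ) < c))
    (by linarith) ?_
  refine (Complex.norm_le_abs_re_add_abs_im _).trans ?_
  simp only [Complex.sub_re, Complex.ofReal_re, Complex.sub_im, Complex.ofReal_im, zero_sub,
    abs_neg]
  rw [abs_of_neg (by linarith), abs_of_pos he1]
  linarith

end IsMultiplicationModel

/-- The operator corresponding to multiplication by the indicator of `{m ≤ r}`. -/
noncomputable def cutoffProjection (W : V ≃ₗᵢ[ℂ] Lp ℂ 2 ρ) {m : X → ℝ} (hm : Measurable m)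
    (r : ℝ) : V →L[ℂ] V :=
  (W.symm.toContinuousLinearEquiv : Lp ℂ 2 ρ →L[ℂ] V) ∘L
    mulBounded (memLp_top_indicator_one (ρ := ρ) (measurableSet_le hm (measurable_const (a := r))))
      ∘L (W.toContinuousLinearEquiv : V →L[ℂ] Lp ℂ 2 ρ)

theorem cutoffProjection_ae (W : V ≃ₗᵢ[ℂ] Lp ℂ 2 ρ) {m : X → ℝ} (hm : Measurable m) (r : ℝ)
    (u : V) : W (cutoffProjection W hm r u) =ᵐ[ρ] {x | m x ≤ r}.indicator (W u) := by
  have h : W (cutoffProjection W hm r u) = mulBounded (memLp_top_indicator_one (ρ := ρ)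
      (measurableSet_le hm (measurable_const (a := r)))) (W u) := by
    simp [cutoffProjection]
  rw [h]
  filter_upwards [coeFn_mulBounded (memLp_top_indicator_one (ρ := ρ)
    (measurableSet_le hm (measurable_const (a := r)))) (W u)] with x hx
  rw [hx]
  by_cases h : m x ≤ r <;> simp [h]

theorem inner_cutoffProjection (W : V ≃ₗᵢ[ℂ] Lp ℂ 2 ρ) {m : X → ℝ} (hm : Measurable m) (r : ℝ)
    (f g : V) : inner ℂ g (cutoffProjection W hm r f) =
      ∫ x in {x | m x ≤ r}, inner ℂ (W g x) (W f x) ∂ρ := by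
  rw [← W.inner_map_map, L2.inner_def, ← integral_indicator (measurableSet_le hm measurable_const)]
  refine integral_congr_ae ?_
  filter_upwards [cutoffProjection_ae W hm r f] with x hx
  rw [hx]
  by_cases h : m x ≤ r <;> simp [h]

theorem isStarProjection_cutoffProjection [CompleteSpace V] (W : V ≃ₗᵢ[ℂ] Lp ℂ 2 ρ) {m : X → ℝ}
    (hm : Measurable m) (r : ℝ) : IsStarProjection (cutoffProjection W hm r) where
  isIdempotentElem := by
    ext u
    refine W.injective (Lp.ext ?_)
    filter_upwards [cutoffProjection_ae W hm r u,
      cutoffProjection_ae W hm r (cutoffProjection W hm r u)] with x h1 h2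
    rw [mul_apply_eq_comp, h2, h1]
    by_cases h : m x ≤ r <;> simp [h, h1]
  isSelfAdjoint := by
    rw [ContinuousLinearMap.isSelfAdjoint_iff_isSymmetric]
    intro f g
    change inner ℂ (cutoffProjection W hm r f) g = inner ℂ f (cutoffProjection W hm r g)
    rw [← inner_conj_symm, inner_cutoffProjection, inner_cutoffProjection, ← integral_conj]
    simp only [inner_conj_symm]

namespace IsMultiplicationModel

variable [CompleteSpace V] {A : V →ₗ.[ℂ] V} {W : V ≃ₗᵢ[ℂ] Lp ℂ 2 ρ} {m : X → ℝ}

theorem isReducingBelow_cutoffProjection (hA : IsMultiplicationModel A W m) (hm : Measurable m)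
    (r : ℝ) : IsReducingBelow A r (cutoffProjection W hm r) where
  isStarProjection := isStarProjection_cutoffProjection W hm r
  reduces g := by
    refine hA.exists_apply_eq ?_
    filter_upwards [cutoffProjection_ae W hm r g, cutoffProjection_ae W hm r (A g),
      hA.apply_ae g] with x h1 h2 h3
    rw [h1, h2]
    by_cases h : m x ≤ r <;> simp [h, h3]
  form_le u hu := by
    have hfix := ((isStarProjection_cutoffProjection W hm r).mem_range_iff).1 hu
    have h0 := cutoffProjection_ae W hm r (u : V)
    rw [hfix] at h0
    have hre : ∀ v w : V, (inner ℂ v w).re = ∫ x, (inner ℂ (W v x) (W w x)).re ∂ρ := by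
      intro v w
      rw [← W.inner_map_map, L2.inner_def]
      exact (integral_re (L2.integrable_inner (𝕜 := ℂ) (W v) (W w))).symm
    rw [hre, hre, ← integral_const_mul]
    refine integral_mono_ae (L2.integrable_inner (𝕜 := ℂ) (W (u : V)) (W (A u))).re
      ((L2.integrable_inner (𝕜 := ℂ) (W (u : V)) (W (u : V))).re.const_mul r) ?_
    filter_upwards [h0, hA.apply_ae u] with x h1 h2
    rw [h2]
    have h3 : (inner ℂ (W (u : V) x) ((m x : ℂ) * W (u : V) x)).re = m x * ‖W (u : V) x‖ ^ 2 := by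
      rw [← smul_eq_mul, inner_smul_right, re_mul_inner_self, Complex.ofReal_re]
    have h4 : (inner ℂ (W (u : V) x) (W (u : V) x)).re = ‖W (u : V) x‖ ^ 2 := by
      simpa using re_mul_inner_self 1 (W (u : V) x)
    rw [h3, h4]
    by_cases h : m x ≤ r
    · gcongr
    · rw [h1]
      simp [h]

/-- Maximality holds because any admissible range consists of vectors supported on {m ≤ r}, which
the cutoff fixes. -/
theorem isSpectralFamily (hA : IsMultiplicationModel A W m) (hm : Measurable m) :
    IsSpectralFamily A (cutoffProjection W hm) := by
  refine fun r => ⟨hA.isReducingBelow_cutoffProjection hm r, fun P hP u hu => ?_⟩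
  rw [(isStarProjection_cutoffProjection W hm r).mem_range_iff]
  refine W.injective (Lp.ext ?_)
  filter_upwards [cutoffProjection_ae W hm r u, hA.ae_eq_zero_of_lt hm hP hu] with x h1 h2
  rw [h1]
  by_cases h : m x ≤ r
  · simp [h]
  · simp [h, h2 (not_le.1 h)]

end IsMultiplicationModel

/-- The measure is the image under m of the integrable density (Wf) · conj(Wg); a Lebesgue null set
has a ρ-null preimage under m. -/
theorem exists_isSpectralMeasure_cutoffProjection (W : V ≃ₗᵢ[ℂ] Lp ℂ 2 ρ) {m : X → ℝ}
    (hm : Measurable m) (hac : ρ.map m ≪ (volume : Measure ℝ)) (f g : V) :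
    ∃ μ : ComplexMeasure ℝ, IsSpectralMeasure (cutoffProjection W hm) f g μ ∧
      VectorMeasure.AbsolutelyContinuous μ (volume : Measure ℝ).toENNRealVectorMeasure := by
  have hint := L2.integrable_inner (𝕜 := ℂ) (W g) (W f)
  refine ⟨(ρ.withDensityᵥ fun x => inner ℂ (W g x) (W f x)).map m, fun r => ?_, ?_⟩
  · rw [VectorMeasure.map_apply _ hm measurableSet_Iic,
      withDensityᵥ_apply hint (hm measurableSet_Iic), inner_cutoffProjection]
    rfl
  · refine VectorMeasure.AbsolutelyContinuous.mk fun S hS h0 => ?_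
    rw [Measure.toENNRealVectorMeasure_apply_measurable hS] at h0
    rw [VectorMeasure.map_apply _ hm hS, withDensityᵥ_apply hint (hm hS)]
    refine setIntegral_measure_zero _ ?_
    rw [← Measure.map_apply hm hS]
    exact hac h0

end SpectralFamilyOfModel

/-! ### Products of test functions separate locally integrable functions. -/

section ProductTestFunctions

theorem integrable_prod_smul {E F : Type*} [TopologicalSpace E]
    [MeasurableSpace E] [BorelSpace E] [TopologicalSpace F] [MeasurableSpace F] [BorelSpace F]
    {μ : Measure E} {ν : Measure F} {G : E × F → ℂ} (hG : Integrable G (μ.prod ν)) {a : E → ℝ} {b : F → ℝ}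
    (ha : Continuous a) (ha' : HasCompactSupport a) (hb : Continuous b)
    (hb' : HasCompactSupport b) : Integrable (fun p => (a p.1 * b p.2) • G p) (μ.prod ν) := by
  obtain ⟨C, hC⟩ := ha.bounded_above_of_compact_support ha'
  obtain ⟨D, hD⟩ := hb.bounded_above_of_compact_support hb'
  have hm : Measurable fun p : E × F => a p.1 * b p.2 :=
    (ha.measurable.comp measurable_fst).mul (hb.measurable.comp measurable_snd)
  refine hG.bdd_smul (C * D) hm.aestronglyMeasurable (Filter.Eventually.of_forall fun p => ?_)
  rw [norm_mul]
  exact mul_le_mul (hC _) (hD _) (norm_nonneg _) ((norm_nonneg _).trans (hC p.1))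

theorem integrable_smul_snd {E F : Type*} [MeasurableSpace E]
    [TopologicalSpace F] [MeasurableSpace F] [BorelSpace F]
    {μ : Measure E} {ν : Measure F} {G : E × F → ℂ} (hG : Integrable G (μ.prod ν)) {b : F → ℝ}
    (hb : Continuous b) (hb' : HasCompactSupport b) :
    Integrable (fun p => b p.2 • G p) (μ.prod ν) := by
  obtain ⟨D, hD⟩ := hb.bounded_above_of_compact_support hb'
  exact hG.bdd_smul D (hb.measurable.comp measurable_snd).aestronglyMeasurable
    (Filter.Eventually.of_forall fun p => hD _)

variable {E F : Type*} [NormedAddCommGroup E] [NormedSpace ℝ E] [FiniteDimensional ℝ E]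
  [MeasurableSpace E] [BorelSpace E] [NormedAddCommGroup F] [NormedSpace ℝ F]
  [FiniteDimensional ℝ F] [MeasurableSpace F] [BorelSpace F]
  {μ : Measure E} {ν : Measure F}
  [SigmaFinite μ] [SigmaFinite ν]

/-- The one-variable fundamental lemma, applied in each variable in turn, replaces test functions by
indicators. The complex measure with density G then vanishes on the π-system of rectangles, hence
everywhere. -/
theorem ae_eq_zero_of_integral_prod_smul_eq_zero_of_integrable {G : E × F → ℂ}
    (hG : Integrable G (μ.prod ν))
    (h : ∀ (a : E → ℝ) (b : F → ℝ), ContDiff ℝ ∞ a → HasCompactSupport a → ContDiff ℝ ∞ b →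
      HasCompactSupport b → ∫ p, (a p.1 * b p.2) • G p ∂μ.prod ν = 0) :
    G =ᵐ[μ.prod ν] 0 := by
  have h1 : ∀ b : F → ℝ, ContDiff ℝ ∞ b → HasCompactSupport b →
      ∀ᵐ x ∂μ, ∫ y, b y • G (x, y) ∂ν = 0 := by
    intro b hb hb'
    have hI := integrable_smul_snd hG hb.continuous hb'
    refine ae_eq_zero_of_integral_contDiff_smul_eq_zero hI.integral_prod_left.locallyIntegrable
      fun a ha ha' => ?_
    rw [← h a b ha ha' hb hb',
      integral_prod _ (integrable_prod_smul hG ha.continuous ha' hb.continuous hb')]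
    refine integral_congr_ae (Filter.Eventually.of_forall fun x => ?_)
    simp only
    rw [← integral_smul]
    simp only [mul_smul]
  -- The null set depends on A, which is harmless because the result is only integrated over y.
  have h2 : ∀ A : Set E, ∀ᵐ y ∂ν, ∫ x in A, G (x, y) ∂μ = 0 := by
    intro A
    have hGA : Integrable G ((μ.restrict A).prod ν) := by
      refine hG.mono_measure ?_
      calc (μ.restrict A).prod ν = (μ.restrict A).prod (ν.restrict univ) := by
            rw [Measure.restrict_univ]
        _ = (μ.prod ν).restrict (A ×ˢ univ) := Measure.prod_restrict _ _
        _ ≤ _ := Measure.restrict_le_self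
    refine ae_eq_zero_of_integral_contDiff_smul_eq_zero hGA.integral_prod_right.locallyIntegrable
      fun b hb hb' => ?_
    have hI := integrable_smul_snd hGA hb.continuous hb'
    calc ∫ y, b y • ∫ x in A, G (x, y) ∂μ ∂ν = ∫ y, ∫ x in A, b y • G (x, y) ∂μ ∂ν := by
          simp only [integral_smul]
      _ = ∫ x in A, ∫ y, b y • G (x, y) ∂ν ∂μ := by
          rw [← integral_prod_symm (fun p => b p.2 • G p) hI, integral_prod _ hI]
      _ = 0 := integral_eq_zero_of_ae (ae_restrict_of_ae (h1 b hb hb'))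
  have h3 : ∀ (A : Set E) (B : Set F), ∫ p in A ×ˢ B, G p ∂μ.prod ν = 0 := by
    intro A B
    have hI : Integrable G ((μ.restrict A).prod (ν.restrict B)) := by
      rw [Measure.prod_restrict]
      exact hG.integrableOn
    rw [← Measure.prod_restrict, integral_prod_symm _ hI]
    exact integral_eq_zero_of_ae (ae_restrict_of_ae (h2 A))
  refine hG.ae_eq_of_withDensityᵥ_eq (integrable_zero _ _ _) ?_
  change _ = (μ.prod ν).withDensityᵥ (0 : E × F → ℂ)
  rw [withDensityᵥ_zero]
  refine VectorMeasure.ext_of_generateFrom _ ?_ generateFrom_prod.symm isPiSystem_prod ?_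
  · rintro _ ⟨A, hA, B, hB, rfl⟩
    rw [withDensityᵥ_apply hG (MeasurableSet.prod hA hB), h3]
    rfl
  · rw [← univ_prod_univ, withDensityᵥ_apply hG (MeasurableSet.univ.prod MeasurableSet.univ), h3]
    rfl

/-- A locally integrable function on a product which annihilates all products of test functions
vanishes almost everywhere. -/
theorem ae_eq_zero_of_integral_prod_smul_eq_zero {G : E × F → ℂ}
    (hG : LocallyIntegrable G (μ.prod ν))
    (h : ∀ (a : E → ℝ) (b : F → ℝ), ContDiff ℝ ∞ a → HasCompactSupport a → ContDiff ℝ ∞ b →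
      HasCompactSupport b → ∫ p, (a p.1 * b p.2) • G p ∂μ.prod ν = 0) :
    G =ᵐ[μ.prod ν] 0 := by
  have hN : ∀ N : ℕ, ∀ᵐ p ∂μ.prod ν, p ∈ Metric.closedBall (0 : E × F) N → G p = 0 := by
    intro N
    -- Multiplying by bumps equal to 1 on the ball of radius N makes G integrable; in the hypothesis
    -- they are absorbed into a and b.
    let c : ContDiffBump (0 : E) := ⟨N + 1, N + 2, by positivity, by linarith⟩
    let d : ContDiffBump (0 : F) := ⟨N + 1, N + 2, by positivity, by linarith⟩
    have hcd : Integrable (fun p => (c p.1 * d p.2) • G p) (μ.prod ν) := by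
      refine (hG.integrable_smul_left_of_hasCompactSupport (g := fun p : E × F => c p.1 * d p.2)
        ?_ ?_)
      · exact (c.continuous.comp continuous_fst).mul (d.continuous.comp continuous_snd)
      · refine HasCompactSupport.of_support_subset_isCompact
          (c.hasCompactSupport.isCompact.prod d.hasCompactSupport.isCompact) fun p hp => ?_
        rw [Function.mem_support, mul_ne_zero_iff] at hp
        exact ⟨subset_tsupport _ hp.1, subset_tsupport _ hp.2⟩
    have hz := ae_eq_zero_of_integral_prod_smul_eq_zero_of_integrable hcd fun a b ha ha' hb hb' => by
      rw [← h (fun x => a x * c x) (fun y => b y * d y) (ha.mul c.contDiff) ha'.mul_right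
        (hb.mul d.contDiff) hb'.mul_right]
      refine integral_congr_ae (Filter.Eventually.of_forall fun p => ?_)
      simp only
      rw [smul_smul]
      congr 1
      ring
    filter_upwards [hz] with p hp hpN
    rw [mem_closedBall_zero_iff, Prod.norm_def, max_le_iff] at hpN
    rw [c.one_of_mem_closedBall (by simp only [mem_closedBall_zero_iff, c]; linarith),
      d.one_of_mem_closedBall (by simp only [mem_closedBall_zero_iff, d]; linarith)] at hp
    simpa using hp
  rw [← ae_all_iff] at hN
  filter_upwards [hN] with p hp
  obtain ⟨N, hpN⟩ := exists_nat_ge ‖p‖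
  exact hp N (by simpa using hpN)

end ProductTestFunctions

/-! ### The Fourier transform in the first variable. -/

section PartialFourier

open FourierTransform SchwartzMap

variable {Y : Type*} [MeasureSpace Y]

/-- The Fourier transform in the first variable. -/
noncomputable def partialFourier (f : ℝ × Y → ℂ) (p : ℝ × Y) : ℂ :=
  𝓕 (fun x : ℝ => f (x, p.2)) p.1

/-- The inverse Fourier transform in the first variable. -/
noncomputable def partialFourierInv (f : ℝ × Y → ℂ) (p : ℝ × Y) : ℂ :=
  𝓕⁻ (fun x : ℝ => f (x, p.2)) p.1

variable (Y) in
/-- The square integrable functions on `ℝ × Y` which are Schwartz functions of the first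
variable. -/
def schwartzSlices : Submodule ℂ (ℝ × Y → ℂ) where
  carrier := {f | StronglyMeasurable f ∧ MemLp f 2 volume ∧ ∀ y, ∃ g : 𝓢(ℝ, ℂ), ∀ x, f (x, y) = g x}
  zero_mem' := ⟨stronglyMeasurable_zero, MemLp.zero, fun _ => ⟨0, fun _ => rfl⟩⟩
  add_mem' := by
    rintro f g ⟨hf, hf', hfs⟩ ⟨hg, hg', hgs⟩
    refine ⟨hf.add hg, hf'.add hg', fun y => ?_⟩
    obtain ⟨a, ha⟩ := hfs y
    obtain ⟨b, hb⟩ := hgs y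
    exact ⟨a + b, fun x => by simp [ha, hb]⟩
  smul_mem' := by
    rintro c f ⟨hf, hf', hfs⟩
    refine ⟨hf.const_smul c, hf'.const_smul c, fun y => ?_⟩
    obtain ⟨a, ha⟩ := hfs y
    exact ⟨c • a, fun x => by simp [ha]⟩

theorem partialFourier_of_slice {Y : Type*} {f : ℝ × Y → ℂ} {y : Y} {g : 𝓢(ℝ, ℂ)} (h : ∀ x, f (x, y) = g x)
    (ξ : ℝ) : partialFourier f (ξ, y) = 𝓕 g ξ := by
  rw [partialFourier, SchwartzMap.fourier_coe, ← funext h]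

theorem partialFourierInv_of_slice {Y : Type*} {f : ℝ × Y → ℂ} {y : Y} {g : 𝓢(ℝ, ℂ)}
    (h : ∀ x, f (x, y) = g x) (ξ : ℝ) : partialFourierInv f (ξ, y) = 𝓕⁻ g ξ := by
  rw [partialFourierInv, SchwartzMap.fourierInv_coe, ← funext h]

theorem stronglyMeasurable_partialFourier {f : ℝ × Y → ℂ} (hf : StronglyMeasurable f) :
    StronglyMeasurable (partialFourier f) := by
  have h : StronglyMeasurable fun q : (ℝ × Y) × ℝ =>
      Real.fourierChar (-(q.2 * q.1.1)) • f (q.2, q.1.2) := by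
    have h1 : Continuous fun q : ℝ × ℝ => (Real.fourierChar (-(q.1 * q.2)) : ℂ) := by fun_prop
    have h2 : Measurable fun q : (ℝ × Y) × ℝ => (Real.fourierChar (-(q.2 * q.1.1)) : ℂ) :=
      h1.measurable.comp (measurable_snd.prodMk (measurable_fst.comp measurable_fst))
    exact h2.stronglyMeasurable.smul (hf.comp_measurable
      (measurable_snd.prodMk (measurable_snd.comp measurable_fst)))
  have := h.integral_prod_right' (ν := (volume : Measure ℝ))
  convert this using 2 with p
  rw [partialFourier, Real.fourier_real_eq]

theorem partialFourierInv_eq {Y : Type*} (f : ℝ × Y → ℂ) (p : ℝ × Y) :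
    partialFourierInv f p = partialFourier f (-p.1, p.2) := by
  rw [partialFourierInv, partialFourier, Real.fourierInv_eq_fourier_neg]

theorem stronglyMeasurable_partialFourierInv {f : ℝ × Y → ℂ} (hf : StronglyMeasurable f) :
    StronglyMeasurable (partialFourierInv f) := by
  rw [funext (partialFourierInv_eq f)]
  exact (stronglyMeasurable_partialFourier hf).comp_measurable
    (measurable_fst.neg.prodMk measurable_snd)

theorem lintegral_enorm_sq_fourier (g : 𝓢(ℝ, ℂ)) :
    ∫⁻ ξ, ‖𝓕 g ξ‖ₑ ^ (2 : ℝ) = ∫⁻ x, ‖g x‖ₑ ^ (2 : ℝ) := by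
  have h : eLpNorm (𝓕 g : 𝓢(ℝ, ℂ)) 2 volume = eLpNorm g 2 volume := by
    rw [← eLpNorm_congr_ae ((𝓕 g : 𝓢(ℝ, ℂ)).coeFn_toLp 2 volume),
      ← eLpNorm_congr_ae (g.coeFn_toLp 2 volume), ← Lp.enorm_def, ← Lp.enorm_def,
      enorm_eq_iff_norm_eq]
    exact norm_fourier_toL2_eq g
  rw [eLpNorm_eq_lintegral_rpow_enorm_toReal (by simp) (by simp),
    eLpNorm_eq_lintegral_rpow_enorm_toReal (by simp) (by simp)] at h
  exact ENNReal.rpow_left_injective (by simp) h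

/-- Tonelli reduces L² isometry to each line, where Plancherel for Schwartz functions applies. -/
theorem eLpNorm_eq_of_slices [SFinite (volume : Measure Y)] {f g : ℝ × Y → ℂ}
    (hf : StronglyMeasurable f) (hg : StronglyMeasurable g)
    (h : ∀ y, ∫⁻ x, ‖f (x, y)‖ₑ ^ (2 : ℝ) = ∫⁻ x, ‖g (x, y)‖ₑ ^ (2 : ℝ)) :
    eLpNorm f 2 volume = eLpNorm g 2 volume := by
  rw [eLpNorm_eq_lintegral_rpow_enorm_toReal (by simp) (by simp),
    eLpNorm_eq_lintegral_rpow_enorm_toReal (by simp) (by simp), Measure.volume_eq_prod]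
  simp only [ENNReal.toReal_ofNat]
  rw [lintegral_prod_symm' _ (hf.enorm.pow_const _), lintegral_prod_symm' _ (hg.enorm.pow_const _)]
  simp only [h]

theorem eLpNorm_partialFourier [SFinite (volume : Measure Y)] {f : ℝ × Y → ℂ}
    (hf : f ∈ schwartzSlices Y) : eLpNorm (partialFourier f) 2 volume = eLpNorm f 2 volume := by
  refine eLpNorm_eq_of_slices (stronglyMeasurable_partialFourier hf.1) hf.1 fun y => ?_
  obtain ⟨g, hg⟩ := hf.2.2 y
  simp only [partialFourier_of_slice hg, hg, lintegral_enorm_sq_fourier]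

theorem eLpNorm_partialFourierInv [SFinite (volume : Measure Y)] {f : ℝ × Y → ℂ}
    (hf : f ∈ schwartzSlices Y) : eLpNorm (partialFourierInv f) 2 volume = eLpNorm f 2 volume := by
  refine eLpNorm_eq_of_slices (stronglyMeasurable_partialFourierInv hf.1) hf.1 fun y => ?_
  obtain ⟨g, hg⟩ := hf.2.2 y
  simp only [partialFourierInv_of_slice hg, hg]
  rw [← lintegral_enorm_sq_fourier (𝓕⁻ g), FourierTransform.fourier_fourierInv_eq]

theorem partialFourier_mem [SFinite (volume : Measure Y)] {f : ℝ × Y → ℂ}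
    (hf : f ∈ schwartzSlices Y) : partialFourier f ∈ schwartzSlices Y := by
  refine ⟨stronglyMeasurable_partialFourier hf.1,
    ⟨(stronglyMeasurable_partialFourier hf.1).aestronglyMeasurable, ?_⟩, fun y => ?_⟩
  · rw [eLpNorm_partialFourier hf]
    exact hf.2.1.2
  · obtain ⟨g, hg⟩ := hf.2.2 y
    exact ⟨𝓕 g, partialFourier_of_slice hg⟩

theorem partialFourierInv_mem [SFinite (volume : Measure Y)] {f : ℝ × Y → ℂ}
    (hf : f ∈ schwartzSlices Y) : partialFourierInv f ∈ schwartzSlices Y := by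
  refine ⟨stronglyMeasurable_partialFourierInv hf.1,
    ⟨(stronglyMeasurable_partialFourierInv hf.1).aestronglyMeasurable, ?_⟩, fun y => ?_⟩
  · rw [eLpNorm_partialFourierInv hf]
    exact hf.2.1.2
  · obtain ⟨g, hg⟩ := hf.2.2 y
    exact ⟨𝓕⁻ g, partialFourierInv_of_slice hg⟩

variable (Y) in
/-- The Fourier transform in the first variable, on functions which are Schwartz functions of that
variable. -/
noncomputable def partialFourierEquiv [SFinite (volume : Measure Y)] :
    schwartzSlices Y ≃ₗ[ℂ] schwartzSlices Y where
  toFun f := ⟨partialFourier f, partialFourier_mem f.2⟩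
  invFun f := ⟨partialFourierInv f, partialFourierInv_mem f.2⟩
  map_add' f g := by
    ext ⟨ξ, y⟩
    obtain ⟨a, ha⟩ := f.2.2.2 y
    obtain ⟨b, hb⟩ := g.2.2.2 y
    obtain ⟨c, hc⟩ := (f + g).2.2.2 y
    -- A slice determines its Schwartz representative, so additivity reduces to that of the Schwartz
    -- transform.
    have habc : c = a + b := by
      ext x
      rw [add_apply, ← ha, ← hb, ← hc]
      rfl
    change partialFourier ((f + g : schwartzSlices Y) : ℝ × Y → ℂ) (ξ, y) =
      partialFourier f (ξ, y) + partialFourier g (ξ, y)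
    rw [partialFourier_of_slice ha, partialFourier_of_slice hb, partialFourier_of_slice hc, habc,
      FourierTransform.fourier_add, add_apply]
  map_smul' r f := by
    ext ⟨ξ, y⟩
    obtain ⟨a, ha⟩ := f.2.2.2 y
    obtain ⟨c, hc⟩ := (r • f).2.2.2 y
    have hac : c = r • a := by
      ext x
      rw [smul_apply, ← ha, ← hc]
      rfl
    change partialFourier ((r • f : schwartzSlices Y) : ℝ × Y → ℂ) (ξ, y) =
      r • partialFourier f (ξ, y)
    rw [partialFourier_of_slice ha, partialFourier_of_slice hc, hac,
      FourierTransform.fourier_smul, smul_apply]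
  left_inv f := by
    ext ⟨x, y⟩
    obtain ⟨a, ha⟩ := f.2.2.2 y
    simp only
    rw [partialFourierInv_of_slice (partialFourier_of_slice ha),
      FourierTransform.fourierInv_fourier_eq, ha]
  right_inv f := by
    ext ⟨x, y⟩
    obtain ⟨a, ha⟩ := f.2.2.2 y
    simp only
    rw [partialFourier_of_slice (partialFourierInv_of_slice ha),
      FourierTransform.fourier_fourierInv_eq, ha]

variable (Y) in
/-- The class in `L²` of a function which is a Schwartz function of the first variable. -/
noncomputable def schwartzSlicesToL2 : schwartzSlices Y →ₗ[ℂ] Lp ℂ 2 (volume : Measure (ℝ × Y)) where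
  toFun f := f.2.2.1.toLp f
  map_add' _ _ := rfl
  map_smul' _ _ := rfl

theorem coeFn_schwartzSlicesToL2 (f : schwartzSlices Y) :
    schwartzSlicesToL2 Y f =ᵐ[volume] (f : ℝ × Y → ℂ) :=
  f.2.2.1.coeFn_toLp

theorem norm_schwartzSlicesToL2_partialFourierEquiv [SFinite (volume : Measure Y)]
    (f : schwartzSlices Y) :
    ‖schwartzSlicesToL2 Y (partialFourierEquiv Y f)‖ = ‖schwartzSlicesToL2 Y f‖ := by
  rw [← enorm_eq_iff_norm_eq, Lp.enorm_def, Lp.enorm_def,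
    eLpNorm_congr_ae (coeFn_schwartzSlicesToL2 _), eLpNorm_congr_ae (coeFn_schwartzSlicesToL2 _)]
  exact eLpNorm_partialFourier f.2

end PartialFourier

/-! ### Closed graphs and cores of multiplication operators. -/

section Core

variable {V X : Type*} [NormedAddCommGroup V] [InnerProductSpace ℂ V]
  [MeasurableSpace X] {ρ : Measure X}

/-- The graph of the maximal operator carried by `W` to multiplication by `m`. -/
def multiplicationGraph (W : V ≃ₗᵢ[ℂ] Lp ℂ 2 ρ) (m : X → ℝ) : Submodule ℂ (V × V) where
  carrier := {p | W p.2 =ᵐ[ρ] fun x => (m x : ℂ) * W p.1 x}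
  zero_mem' := by
    change W 0 =ᵐ[ρ] fun x => (m x : ℂ) * W 0 x
    rw [map_zero]
    filter_upwards [Lp.coeFn_zero ℂ 2 ρ] with x hx
    rw [hx, Pi.zero_apply, mul_zero]
  add_mem' := by
    intro p q hp hq
    change W (p.2 + q.2) =ᵐ[ρ] fun x => (m x : ℂ) * W (p.1 + q.1) x
    rw [map_add, map_add]
    filter_upwards [hp, hq, Lp.coeFn_add (W p.1) (W q.1), Lp.coeFn_add (W p.2) (W q.2)]
      with x h1 h2 h3 h4
    rw [h3, h4, Pi.add_apply, Pi.add_apply, h1, h2, mul_add]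
  smul_mem' := by
    intro c p hp
    change W (c • p.2) =ᵐ[ρ] fun x => (m x : ℂ) * W (c • p.1) x
    rw [map_smul, map_smul]
    filter_upwards [hp, Lp.coeFn_smul c (W p.1), Lp.coeFn_smul c (W p.2)] with x h1 h2 h3
    rw [h2, h3, Pi.smul_apply, Pi.smul_apply, h1, smul_eq_mul, smul_eq_mul]
    ring

variable {W : V ≃ₗᵢ[ℂ] Lp ℂ 2 ρ} {m : X → ℝ}

theorem mem_multiplicationGraph {p : V × V} :
    p ∈ multiplicationGraph W m ↔ W p.2 =ᵐ[ρ] fun x => (m x : ℂ) * W p.1 x :=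
  Iff.rfl

theorem norm_ofReal_add_I_sq (t : ℝ) : ‖(t : ℂ) + Complex.I‖ ^ 2 = t ^ 2 + 1 := by
  rw [Complex.sq_norm, Complex.normSq_apply]
  simp
  ring

theorem one_le_norm_ofReal_add_I (t : ℝ) : 1 ≤ ‖(t : ℂ) + Complex.I‖ := by
  have := norm_ofReal_add_I_sq t
  nlinarith [norm_nonneg ((t : ℂ) + Complex.I), sq_nonneg t]

theorem abs_le_norm_ofReal_add_I (t : ℝ) : |t| ≤ ‖(t : ℂ) + Complex.I‖ := by
  simpa using Complex.abs_re_le_norm ((t : ℂ) + Complex.I)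

/-- Dividing the graph relation by m + i turns it into equality of two bounded operators, since 1/(m
+ i) and m/(m + i) are bounded. -/
theorem isClosed_multiplicationGraph (hm : Measurable m) :
    IsClosed (multiplicationGraph W m : Set (V × V)) := by
  have hne : ∀ t : ℝ, (t : ℂ) + Complex.I ≠ 0 := fun t =>
    norm_pos_iff.1 (one_pos.trans_le (one_le_norm_ofReal_add_I t))
  have h1 : MemLp (fun x => ((m x : ℂ) + Complex.I)⁻¹) ⊤ ρ := by
    refine memLp_top_of_bound (Measurable.aestronglyMeasurable (by fun_prop)) 1
      (Filter.Eventually.of_forall fun x => ?_)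
    rw [norm_inv]
    exact inv_le_one_of_one_le₀ (one_le_norm_ofReal_add_I _)
  have h2 : MemLp (fun x => ((m x : ℂ) + Complex.I)⁻¹ * m x) ⊤ ρ := by
    refine memLp_top_of_bound (Measurable.aestronglyMeasurable (by fun_prop)) 1
      (Filter.Eventually.of_forall fun x => ?_)
    rw [norm_mul, norm_inv, Complex.norm_real, Real.norm_eq_abs, inv_mul_le_iff₀
      (one_pos.trans_le (one_le_norm_ofReal_add_I _)), mul_one]
    exact abs_le_norm_ofReal_add_I _
  have h : (multiplicationGraph W m : Set (V × V)) =
      {p | mulBounded h1 (W p.2) = mulBounded h2 (W p.1)} := by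
    ext p
    rw [SetLike.mem_coe, mem_multiplicationGraph, mem_ofPred_eq, Lp.ext_iff]
    constructor
    · intro h
      filter_upwards [h, coeFn_mulBounded h1 (W p.2), coeFn_mulBounded h2 (W p.1)] with x h3 h4 h5
      rw [h4, h5, h3, mul_assoc]
    · intro h
      filter_upwards [h, coeFn_mulBounded h1 (W p.2), coeFn_mulBounded h2 (W p.1)] with x h3 h4 h5
      rw [h4, h5, mul_assoc] at h3
      exact mul_left_cancel₀ (inv_ne_zero (hne _)) h3
  rw [h]
  exact isClosed_eq ((mulBounded h1).continuous.comp (W.continuous.comp continuous_snd))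
    ((mulBounded h2).continuous.comp (W.continuous.comp continuous_fst))

theorem coeFn_add_I_smul {p : V × V} (hp : p ∈ multiplicationGraph W m) :
    W (p.2 + Complex.I • p.1) =ᵐ[ρ] fun x => ((m x : ℂ) + Complex.I) * W p.1 x := by
  rw [map_add, map_smul]
  filter_upwards [mem_multiplicationGraph.1 hp, Lp.coeFn_add (W p.2) (Complex.I • W p.1),
    Lp.coeFn_smul Complex.I (W p.1)] with x h1 h2 h3
  rw [h2, Pi.add_apply, h3, Pi.smul_apply, h1, smul_eq_mul, add_mul]

theorem norm_le_norm_add_I_smul {p : V × V} (hp : p ∈ multiplicationGraph W m) :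
    ‖p‖ ≤ ‖p.2 + Complex.I • p.1‖ := by
  rw [Prod.norm_def, ← W.norm_map (p.2 + _), ← W.norm_map p.1, ← W.norm_map p.2]
  refine max_le (Lp.norm_le_norm_of_ae_le ?_) (Lp.norm_le_norm_of_ae_le ?_)
  · filter_upwards [coeFn_add_I_smul hp] with x h1
    rw [h1, norm_mul]
    exact le_mul_of_one_le_left (norm_nonneg _) (one_le_norm_ofReal_add_I _)
  · filter_upwards [mem_multiplicationGraph.1 hp, coeFn_add_I_smul hp] with x h1 h2
    rw [h1, h2, norm_mul, norm_mul, Complex.norm_real]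
    exact mul_le_mul_of_nonneg_right (abs_le_norm_ofReal_add_I _) (norm_nonneg _)

/-- A linear part of the graph of a multiplication operator `A` on which `A + i` has dense range is
a core. -/
theorem topologicalClosure_eq_multiplicationGraph [CompleteSpace V] (hm : Measurable m)
    {g : Submodule ℂ (V × V)} (hg : g ≤ multiplicationGraph W m)
    (hdense : ∀ h : V, (∀ p ∈ g.topologicalClosure, inner ℂ (p.2 + Complex.I • p.1) h = 0) →
      h = 0) : g.topologicalClosure = multiplicationGraph W m := by
  have hle := g.topologicalClosure_minimal hg (isClosed_multiplicationGraph hm)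
  refine le_antisymm hle fun p hp => ?_
  -- j sends (u, Au) to (A + i)u and does not decrease norms on the graph, so approximating j p by j
  -- q approximates p by q.
  let j : V × V →ₗ[ℂ] V := LinearMap.snd ℂ V V + Complex.I • LinearMap.fst ℂ V V
  have hj : (g.topologicalClosure.map j).topologicalClosure = ⊤ := by
    rw [Submodule.topologicalClosure_eq_top_iff, Submodule.eq_bot_iff]
    intro h hh
    exact hdense h fun q hq => hh (j q) (Submodule.mem_map_of_mem hq)
  have hp' : j p ∈ closure (g.topologicalClosure.map j : Set V) := by
    rw [← Submodule.topologicalClosure_coe, hj]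
    trivial
  have : p ∈ closure (g.topologicalClosure : Set (V × V)) := by
    rw [Metric.mem_closure_iff] at hp' ⊢
    intro ε hε
    obtain ⟨_, ⟨q, hq, rfl⟩, hqε⟩ := hp' ε hε
    refine ⟨q, hq, lt_of_le_of_lt ?_ hqε⟩
    rw [dist_eq_norm, dist_eq_norm, ← map_sub]
    exact norm_le_norm_add_I_smul (Submodule.sub_mem _ hp (hle hq))
  rwa [g.isClosed_topologicalClosure.closure_eq] at this

theorem isMultiplicationModel_closure {A : V →ₗ.[ℂ] V}
    (hA : A.graph.topologicalClosure = multiplicationGraph W m) :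
    IsMultiplicationModel A.closure W m := by
  have hsingle : ∀ p ∈ A.graph.topologicalClosure, p.1 = 0 → p.2 = 0 := by
    intro p hp h0
    rw [hA, mem_multiplicationGraph, h0, map_zero] at hp
    rw [← map_eq_zero_iff W W.injective]
    refine Lp.ext ?_
    filter_upwards [hp, Lp.coeFn_zero ℂ 2 ρ] with x h1 h2
    rw [h1, h2]
    simp
  -- `LinearPMap.closure` returns A itself when A is not closable, so closability must be
  -- established first.
  have hcl : A.IsClosable :=
    ⟨A.graph.topologicalClosure.toLinearPMap,
      (Submodule.toLinearPMap_graph_eq _ hsingle).symm⟩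
  intro p
  rw [← hcl.graph_closure_eq_closure_graph, hA, mem_multiplicationGraph]

end Core

/-! ### The symbol of the shear flow. -/

section ShearFourier

open FourierTransform SchwartzMap

variable {n : ℕ}

theorem hasCompactSupport_slice {f : ShearSpace n → ℂ} (hf : HasCompactSupport f)
    (y : EuclideanSpace ℝ (Fin n)) : HasCompactSupport fun x : ℝ => f (x, y) := by
  refine HasCompactSupport.of_support_subset_isCompact (hf.isCompact.image continuous_fst)
    fun x hx => ?_
  exact ⟨(x, y), subset_tsupport _ hx, rfl⟩

theorem mem_schwartzSlices_of_isTestFn {f : ShearSpace n → ℂ} (hf : IsTestFn f) :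
    f ∈ schwartzSlices (EuclideanSpace ℝ (Fin n)) := by
  refine ⟨hf.1.continuous.stronglyMeasurable, hf.1.continuous.memLp_of_hasCompactSupport hf.2,
    fun y => ⟨(hasCompactSupport_slice hf.2 y).toSchwartzMap
      (hf.1.comp (contDiff_id.prodMk contDiff_const)), fun x => rfl⟩⟩

theorem denseRange_schwartzSlicesToL2 :
    DenseRange (schwartzSlicesToL2 (EuclideanSpace ℝ (Fin n))) := by
  refine (Lp.dense_hasCompactSupport_contDiff (E := ShearSpace n) (F := ℂ)
    (μ := volume) (p := 2) (by simp)).mono ?_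
  rintro u ⟨f, hf, hf', hf''⟩
  have h := mem_schwartzSlices_of_isTestFn ⟨hf'', hf'⟩
  exact ⟨⟨f, h⟩, Lp.ext ((coeFn_schwartzSlicesToL2 ⟨f, h⟩).trans hf.symm)⟩

variable (n) in
/-- The Fourier transform in `x₁`, as a unitary operator on `L²(ℝ^d)`. -/
noncomputable def shearFourier : ShearL2 n ≃ₗᵢ[ℂ] ShearL2 n :=
  (partialFourierEquiv (EuclideanSpace ℝ (Fin n))).extendOfIsometry (schwartzSlicesToL2 _)
    (schwartzSlicesToL2 _) denseRange_schwartzSlicesToL2 denseRange_schwartzSlicesToL2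
    norm_schwartzSlicesToL2_partialFourierEquiv

theorem shearFourier_ae {u : ShearL2 n} {f : ShearSpace n → ℂ}
    (hf : f ∈ schwartzSlices (EuclideanSpace ℝ (Fin n))) (hu : u =ᵐ[volume] f) :
    shearFourier n u =ᵐ[volume] partialFourier f := by
  have h : u = schwartzSlicesToL2 _ ⟨f, hf⟩ :=
    Lp.ext (hu.trans (coeFn_schwartzSlicesToL2 ⟨f, hf⟩).symm)
  rw [h, shearFourier, LinearEquiv.extendOfIsometry_eq]
  exact coeFn_schwartzSlicesToL2 _

/-- The symbol `2π ψ(x') ξ₁` of the shear flow. -/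
noncomputable def shearSymbol (ψ : EuclideanSpace ℝ (Fin n) → ℝ) (p : ShearSpace n) : ℝ :=
  2 * Real.pi * ψ p.2 * p.1

variable {ψ : EuclideanSpace ℝ (Fin n) → ℝ}

theorem continuous_shearSymbol (hψ : Continuous ψ) : Continuous (shearSymbol ψ) := by
  unfold shearSymbol
  fun_prop

theorem shearAction_of_slice {f : ShearSpace n → ℂ} {y : EuclideanSpace ℝ (Fin n)}
    {g : 𝓢(ℝ, ℂ)} (h : ∀ x, f (x, y) = g x) (x : ℝ) :
    shearAction ψ f (x, y) = ((-Complex.I * (ψ y : ℂ)) • derivCLM ℂ ℂ g) x := by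
  rw [shearAction, smul_apply, derivCLM_apply, smul_eq_mul]
  simp only [h]

/-- On a line ψ is constant, and differentiation becomes 2πiξ; the factor -i makes the symbol real.
-/
theorem partialFourier_shearAction {f : ShearSpace n → ℂ}
    (hf : f ∈ schwartzSlices (EuclideanSpace ℝ (Fin n))) (p : ShearSpace n) :
    partialFourier (shearAction ψ f) p = (shearSymbol ψ p : ℂ) * partialFourier f p := by
  obtain ⟨ξ, y⟩ := p
  obtain ⟨g, hg⟩ := hf.2.2 y
  have hd : 𝓕 (derivCLM ℂ ℂ g) ξ = (2 * Real.pi * Complex.I * ξ) • 𝓕 g ξ := by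
    rw [SchwartzMap.fourier_coe, SchwartzMap.fourier_coe]
    exact congrFun (Real.fourier_deriv g.integrable g.differentiable
      (derivCLM ℂ ℂ g).integrable) ξ
  rw [partialFourier_of_slice (shearAction_of_slice hg), partialFourier_of_slice hg,
    FourierTransform.fourier_smul, smul_apply, hd, shearSymbol]
  push_cast
  simp only [smul_eq_mul]
  linear_combination (-(ψ y : ℂ) * 2 * Real.pi * ξ * 𝓕 g ξ) * Complex.I_mul_I

theorem deriv_slice_eq_fderiv {f : ShearSpace n → ℂ} (hf : IsTestFn f) (p : ShearSpace n) :
    deriv (fun s : ℝ => f (s, p.2)) p.1 = fderiv ℝ f p (1, 0) := by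
  have h1 : HasFDerivAt f (fderiv ℝ f (p.1, p.2)) (p.1, p.2) :=
    (hf.1.differentiable (by simp) p).hasFDerivAt
  have h2 : HasDerivAt (fun s : ℝ => (s, p.2)) ((1 : ℝ), (0 : EuclideanSpace ℝ (Fin n))) p.1 :=
    (hasDerivAt_id p.1).prodMk (hasDerivAt_const p.1 p.2)
  exact (h1.comp_hasDerivAt p.1 h2).deriv

theorem continuous_shearAction (hψ : Continuous ψ) {f : ShearSpace n → ℂ} (hf : IsTestFn f) :
    Continuous (shearAction ψ f) := by
  have h : shearAction ψ f = fun p => -Complex.I * (ψ p.2 : ℂ) * fderiv ℝ f p (1, 0) := by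
    funext p
    rw [shearAction, deriv_slice_eq_fderiv hf]
  rw [h]
  have := hf.1.continuous_fderiv (by simp)
  fun_prop

theorem hasCompactSupport_shearAction {f : ShearSpace n → ℂ} (hf : IsTestFn f) :
    HasCompactSupport (shearAction ψ f) := by
  refine (hf.2.fderiv ℝ).mono fun p hp => ?_
  rw [Function.mem_support, shearAction, deriv_slice_eq_fderiv hf] at hp
  intro h0
  simp [h0] at hp

theorem memLp_shearAction (hψ : Continuous ψ) {f : ShearSpace n → ℂ} (hf : IsTestFn f) :
    MemLp (shearAction ψ f) 2 volume :=
  (continuous_shearAction hψ hf).memLp_of_hasCompactSupport (hasCompactSupport_shearAction hf)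

theorem shearAction_mem_schwartzSlices (hψ : Continuous ψ) {f : ShearSpace n → ℂ}
    (hf : IsTestFn f) : shearAction ψ f ∈ schwartzSlices (EuclideanSpace ℝ (Fin n)) := by
  refine ⟨(continuous_shearAction hψ hf).stronglyMeasurable, memLp_shearAction hψ hf, fun y => ?_⟩
  obtain ⟨g, hg⟩ := (mem_schwartzSlices_of_isTestFn hf).2.2 y
  exact ⟨_, shearAction_of_slice hg⟩

theorem shearGraph_le_multiplicationGraph (hψ : Continuous ψ) :
    shearGraph ψ ≤ multiplicationGraph (shearFourier n) (shearSymbol ψ) := by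
  rintro p ⟨f, hf, h1, h2⟩
  rw [mem_multiplicationGraph]
  filter_upwards [shearFourier_ae (mem_schwartzSlices_of_isTestFn hf) h1,
    shearFourier_ae (shearAction_mem_schwartzSlices hψ hf) h2] with x h3 h4
  rw [h3, h4, partialFourier_shearAction (mem_schwartzSlices_of_isTestFn hf)]

/-- For fixed x' the symbol is a dilation of ξ₁ by 2πψ(x') ≠ 0, which preserves null sets; Fubini
finishes. Positivity of ψ enters here. -/
theorem map_shearSymbol_absolutelyContinuous (hψ : Continuous ψ) (hpos : ∀ y, 0 < ψ y) :
    (volume : Measure (ShearSpace n)).map (shearSymbol ψ) ≪ (volume : Measure ℝ) := by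
  have hm := (continuous_shearSymbol hψ).measurable
  refine Measure.AbsolutelyContinuous.mk fun S hS h0 => ?_
  rw [Measure.map_apply hm hS, Measure.volume_eq_prod, Measure.prod_apply_symm (hm hS)]
  refine lintegral_eq_zero_of_ae_eq_zero (Filter.Eventually.of_forall fun y => ?_)
  have hne : 2 * Real.pi * ψ y ≠ 0 := by
    have := hpos y
    positivity
  change volume ((fun x : ℝ => 2 * Real.pi * ψ y * x) ⁻¹' S) = 0
  rw [Real.volume_preimage_mul_left hne, h0, mul_zero]

end ShearFourier

/-! ### Test functions form a core. -/

section ShearCore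

open FourierTransform SchwartzMap

/-- The bound |χ(t) - 1| ≤ |t| makes the error of the cutoff χ(sx) at most s|x|; the extra power of
x is absorbed by Schwartz decay. -/
theorem exists_cutoff : ∃ χ : ℝ → ℝ, ContDiff ℝ ∞ χ ∧ HasCompactSupport χ ∧
    (∀ t, |χ t - 1| ≤ |t|) ∧ ∃ C, 0 ≤ C ∧ ∀ t, |deriv χ t| ≤ C := by
  let c : ContDiffBump (0 : ℝ) := ⟨1, 2, one_pos, one_lt_two⟩
  have hc : ContDiff ℝ ∞ c := c.contDiff
  obtain ⟨C, hC⟩ := (hc.continuous_deriv (by simp)).bounded_above_of_compact_support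
    c.hasCompactSupport.deriv
  refine ⟨c, hc, c.hasCompactSupport, fun t => ?_, C, (norm_nonneg _).trans (hC 0), hC⟩
  by_cases ht : |t| ≤ 1
  · rw [c.one_of_mem_closedBall (by simpa [c] using ht)]
    simp
  · have h0 := c.nonneg (x := t)
    have h1 := c.le_one (x := t)
    rw [abs_le]
    constructor <;> linarith

theorem memLp_tensor {Y : Type*} [MeasureSpace Y] [SFinite (volume : Measure Y)] {a : ℝ → ℂ}
    {b : Y → ℂ} (ha : MemLp a 2 volume) (hb : MemLp b 2 volume) :
    MemLp (fun p : ℝ × Y => a p.1 * b p.2) 2 volume := by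
  refine ⟨ha.1.comp_fst.mul hb.1.comp_snd, ?_⟩
  have ha' := ha.eLpNorm_lt_top
  have hb' := hb.eLpNorm_lt_top
  rw [eLpNorm_lt_top_iff_lintegral_rpow_enorm_lt_top (by simp) (by simp)] at ha' hb' ⊢
  simp only [enorm_mul, ENNReal.toReal_ofNat] at ha' hb' ⊢
  simp only [ENNReal.mul_rpow_of_nonneg _ _ zero_le_two]
  rw [Measure.volume_eq_prod, lintegral_prod_mul (ha.1.enorm.pow_const _) (hb.1.enorm.pow_const _)]
  exact ENNReal.mul_lt_top ha' hb'

variable {n : ℕ} {ψ : EuclideanSpace ℝ (Fin n) → ℝ}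

theorem exists_mem_shearL2_prod {f g : ShearSpace n → ℂ} (hf : MemLp f 2 volume)
    (hg : MemLp g 2 volume) :
    ∃ p : ShearL2 n × ShearL2 n, p.1 =ᵐ[volume] f ∧ p.2 =ᵐ[volume] g :=
  ⟨(hf.toLp, hg.toLp), hf.coeFn_toLp, hg.coeFn_toLp⟩

theorem tensor_mem_schwartzSlices (a : 𝓢(ℝ, ℂ)) {b : EuclideanSpace ℝ (Fin n) → ℂ}
    (hb : Continuous b) (hb' : HasCompactSupport b) :
    (fun p : ShearSpace n => a p.1 * b p.2) ∈ schwartzSlices (EuclideanSpace ℝ (Fin n)) := by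
  refine ⟨Continuous.stronglyMeasurable (by fun_prop),
    memLp_tensor (a.memLp 2) (hb.memLp_of_hasCompactSupport hb'), fun y => ⟨b y • a, fun x => ?_⟩⟩
  rw [smul_apply, smul_eq_mul, mul_comm]

theorem shearAction_tensor {a : ℝ → ℂ} {a' : ℂ} {p : ShearSpace n} (ha : HasDerivAt a a' p.1)
    (b : EuclideanSpace ℝ (Fin n) → ℂ) :
    shearAction ψ (fun p => a p.1 * b p.2) p = -Complex.I * (ψ p.2 : ℂ) * (a' * b p.2) := by
  rw [shearAction]
  simp only
  rw [(ha.mul_const _).deriv]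

theorem memLp_shearAction_tensor (hψ : Continuous ψ) (a : 𝓢(ℝ, ℂ))
    {b : EuclideanSpace ℝ (Fin n) → ℂ} (hb : Continuous b) (hb' : HasCompactSupport b) :
    MemLp (shearAction ψ fun p => a p.1 * b p.2) 2 volume := by
  have h : (shearAction ψ fun p : ShearSpace n => a p.1 * b p.2) =
      fun p => derivCLM ℂ ℂ a p.1 * (-Complex.I * (ψ p.2 : ℂ) * b p.2) := by
    funext p
    rw [shearAction_tensor (a.hasDerivAt p.1), derivCLM_apply]
    ring
  have hc : Continuous fun y => -Complex.I * (ψ y : ℂ) * b y := by fun_prop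
  have hψb : MemLp (fun y => -Complex.I * (ψ y : ℂ) * b y) 2 volume :=
    hc.memLp_of_hasCompactSupport hb'.mul_left
  rw [h]
  exact memLp_tensor ((derivCLM ℂ ℂ a).memLp 2) hψb

/-- Products of a Schwartz function of `x₁` and a test function of `x'` belong to the domain of the
closure of `-i ψ(x') ∂/∂x₁` on test functions. -/
theorem tensor_mem_closure (hψ : Continuous ψ) (a : 𝓢(ℝ, ℂ))
    {b : EuclideanSpace ℝ (Fin n) → ℂ} (hb : ContDiff ℝ ∞ b) (hb' : HasCompactSupport b)
    {p : ShearL2 n × ShearL2 n} (hp1 : p.1 =ᵐ[volume] fun x => a x.1 * b x.2)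
    (hp2 : p.2 =ᵐ[volume] shearAction ψ fun x => a x.1 * b x.2) :
    p ∈ (shearGraph ψ).topologicalClosure := by
  obtain ⟨χ, hχ, hχ', hχ1, C, hC0, hC⟩ := exists_cutoff
  have hψb : MemLp (fun y => (ψ y : ℂ) * b y) 2 volume :=
    Continuous.memLp_of_hasCompactSupport (by fun_prop) hb'.mul_left
  have hx : ∀ (g : 𝓢(ℝ, ℂ)) (x : ℝ), smulLeftCLM ℂ (id : ℝ → ℝ) g x = x * g x := fun g x => by
    rw [smulLeftCLM_apply_apply Function.HasTemperateGrowth.id]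
    simp
  have hxa := memLp_tensor ((smulLeftCLM ℂ (id : ℝ → ℝ) a).memLp 2)
    (hb.continuous.memLp_of_hasCompactSupport hb' (μ := volume) (p := 2))
  -- |xa'| + C|a| dominates, up to the factor s, the two errors (χ(sx) - 1)a' and sχ'(sx)a in the
  -- derivative of χ(sx)a.
  set A : ℝ → ℂ := fun x => ((‖smulLeftCLM ℂ (id : ℝ → ℝ) (derivCLM ℂ ℂ a) x‖ + C * ‖a x‖ : ℝ) : ℂ)
    with hAdef
  have hA : MemLp A 2 volume :=
    ((((smulLeftCLM ℂ (id : ℝ → ℝ) (derivCLM ℂ ℂ a)).memLp 2).norm.add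
      ((a.memLp 2).norm.const_mul C))).ofReal
  obtain ⟨⟨q1, q2⟩, hq1, hq2⟩ := exists_mem_shearL2_prod hxa (memLp_tensor hA hψb)
  simp only at hq1 hq2
  let s : ℕ → ℝ := fun k => (1 / ((k : ℝ) + 1))
  have hs : ∀ k, 0 < s k := fun k => by positivity
  let ak : ℕ → ℝ → ℂ := fun k x => (χ (s k * x) : ℂ) * a x
  let f : ℕ → ShearSpace n → ℂ := fun k x => ak k x.1 * b x.2
  have hak : ∀ k, ContDiff ℝ ∞ (ak k) := fun k =>
    (Complex.ofRealCLM.contDiff.comp (hχ.comp (contDiff_const.mul contDiff_id))).mul (a.smooth _)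
  have hak' : ∀ k, HasCompactSupport (ak k) := fun k => by
    refine HasCompactSupport.mul_right ?_
    refine HasCompactSupport.comp_left (g := ((↑) : ℝ → ℂ)) (f := fun x => χ (s k * x)) ?_
      Complex.ofReal_zero
    exact hχ'.comp_homeomorph (Homeomorph.mulLeft₀ (s k) (hs k).ne')
  have hf : ∀ k, IsTestFn (f k) := fun k => by
    refine ⟨((hak k).comp contDiff_fst).mul (hb.comp contDiff_snd),
      HasCompactSupport.of_support_subset_isCompact ((hak' k).isCompact.prod hb'.isCompact)
        fun x hx => ?_⟩
    rw [Function.mem_support, mul_ne_zero_iff] at hx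
    exact ⟨subset_tsupport _ hx.1, subset_tsupport _ hx.2⟩
  choose P hP1 hP2 using fun k => exists_mem_shearL2_prod
    ((hf k).1.continuous.memLp_of_hasCompactSupport (hf k).2) (memLp_shearAction hψ (hf k))
  have hb1 : ∀ k, ‖(P k - p).1‖ ≤ s k * ‖q1‖ := fun k => by
    refine Lp.norm_le_mul_norm_of_ae_le_mul ?_
    filter_upwards [hP1 k, hp1, hq1, Lp.coeFn_sub (P k).1 p.1] with x h1 h2 h3 h4
    rw [Prod.fst_sub, h4, Pi.sub_apply, h1, h2, h3, hx]
    have h5 : f k x - a x.1 * b x.2 = ((χ (s k * x.1) - 1 : ℝ) : ℂ) * (a x.1 * b x.2) := by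
      simp only [f, ak]
      push_cast
      ring
    rw [h5, norm_mul, Complex.norm_real, Real.norm_eq_abs]
    calc |χ (s k * x.1) - 1| * ‖a x.1 * b x.2‖ ≤ |s k * x.1| * ‖a x.1 * b x.2‖ :=
          mul_le_mul_of_nonneg_right (hχ1 _) (norm_nonneg _)
      _ = s k * ‖(x.1 : ℂ) * a x.1 * b x.2‖ := by
          rw [abs_mul, abs_of_pos (hs k), norm_mul, norm_mul, norm_mul, Complex.norm_real,
            Real.norm_eq_abs]
          ring
  have hb2 : ∀ k, ‖(P k - p).2‖ ≤ s k * ‖q2‖ := fun k => by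
    refine Lp.norm_le_mul_norm_of_ae_le_mul ?_
    filter_upwards [hP2 k, hp2, hq2,
      Lp.coeFn_sub (P k).2 p.2] with x h1 h2 h3 h4
    rw [Prod.snd_sub, h4, Pi.sub_apply, h1, h2, h3]
    have hd : HasDerivAt (ak k) (((deriv χ (s k * x.1) * s k : ℝ) : ℂ) * a x.1 +
        (χ (s k * x.1) : ℂ) * deriv a x.1) x.1 := by
      have h5 : HasDerivAt (fun t => χ (s k * t)) (deriv χ (s k * x.1) * s k) x.1 := by
        have h6 : HasDerivAt (fun t => s k * t) (s k) x.1 := by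
          simpa using (hasDerivAt_id x.1).const_mul (s k)
        exact ((hχ.differentiable (by simp) _).hasDerivAt).comp x.1 h6
      exact h5.ofReal_comp.mul (a.hasDerivAt x.1)
    rw [shearAction_tensor hd, shearAction_tensor (a.hasDerivAt x.1)]
    have h6 : -Complex.I * (ψ x.2 : ℂ) * ((((deriv χ (s k * x.1) * s k : ℝ) : ℂ) * a x.1 +
        (χ (s k * x.1) : ℂ) * deriv a x.1) * b x.2) -
        -Complex.I * (ψ x.2 : ℂ) * (deriv a x.1 * b x.2) =
        (((deriv χ (s k * x.1) * s k : ℝ) : ℂ) * a x.1 +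
          ((χ (s k * x.1) - 1 : ℝ) : ℂ) * deriv a x.1) * (-Complex.I * ((ψ x.2 : ℂ) * b x.2)) := by
      push_cast
      ring
    rw [h6, norm_mul, norm_mul (-Complex.I), norm_neg, Complex.norm_I, one_mul,
      norm_mul (A x.1), ← mul_assoc]
    refine mul_le_mul_of_nonneg_right ?_ (norm_nonneg _)
    have hnA : ‖A x.1‖ = |x.1| * ‖deriv a x.1‖ + C * ‖a x.1‖ := by
      rw [hAdef]
      simp only
      rw [Complex.norm_real, Real.norm_eq_abs, abs_of_nonneg (by positivity), hx, norm_mul,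
        derivCLM_apply, Complex.norm_real, Real.norm_eq_abs]
    rw [hnA]
    refine (norm_add_le _ _).trans ?_
    rw [norm_mul, norm_mul, Complex.norm_real, Complex.norm_real, Real.norm_eq_abs,
      Real.norm_eq_abs, abs_mul, abs_of_pos (hs k)]
    have h7 := hχ1 (s k * x.1)
    rw [abs_mul, abs_of_pos (hs k)] at h7
    calc |deriv χ (s k * x.1)| * s k * ‖a x.1‖ + |χ (s k * x.1) - 1| * ‖deriv a x.1‖
        ≤ C * s k * ‖a x.1‖ + s k * |x.1| * ‖deriv a x.1‖ := by
          have := (hs k).le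
          gcongr
          exact hC _
      _ = s k * (|x.1| * ‖deriv a x.1‖ + C * ‖a x.1‖) := by ring
  have hlim : Filter.Tendsto P Filter.atTop (nhds p) := by
    rw [tendsto_iff_norm_sub_tendsto_zero]
    refine squeeze_zero (fun _ => norm_nonneg _) (g := fun k => s k * max ‖q1‖ ‖q2‖)
      (fun k => ?_) ?_
    · rw [Prod.norm_def, mul_max_of_nonneg _ _ (hs k).le]
      exact max_le_max (hb1 k) (hb2 k)
    · have := (tendsto_one_div_add_atTop_nhds_zero_nat (𝕜 := ℝ)).mul_const (max ‖q1‖ ‖q2‖)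
      rwa [zero_mul] at this
  exact mem_closure_of_tendsto hlim
    (Filter.Eventually.of_forall fun k => ⟨f k, hf k, hP1 k, hP2 k⟩)

/-- By Parseval, orthogonality to (A + i) of tensors says that (m - i)ĥ annihilates every product
αβ. This function is only locally integrable, as m is unbounded. It therefore vanishes, and m - i ≠
0 because m is real. -/
theorem eq_zero_of_inner_closure_eq_zero (hψ : Continuous ψ) {h : ShearL2 n}
    (hh : ∀ p ∈ (shearGraph ψ).topologicalClosure, inner ℂ (p.2 + Complex.I • p.1) h = 0) :
    h = 0 := by
  have hloc : LocallyIntegrable (fun p => ((shearSymbol ψ p : ℂ) - Complex.I) *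
      shearFourier n h p) (volume : Measure (ShearSpace n)) := by
    refine ((Lp.memLp (shearFourier n h)).locallyIntegrable (by simp)).continuous_mul ?_
    have := continuous_shearSymbol hψ
    fun_prop
  have hz : (fun p => ((shearSymbol ψ p : ℂ) - Complex.I) * shearFourier n h p)
      =ᵐ[(volume : Measure (ShearSpace n))] 0 := by
    refine ae_eq_zero_of_integral_prod_smul_eq_zero hloc fun α β hα hα' hβ hβ' => ?_
    have hα1 : ContDiff ℝ ∞ fun x => (α x : ℂ) := Complex.ofRealCLM.contDiff.comp hα
    have hα2 : HasCompactSupport fun x => (α x : ℂ) :=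
      hα'.comp_left (g := ((↑) : ℝ → ℂ)) Complex.ofReal_zero
    have hβ1 : ContDiff ℝ ∞ fun x => (β x : ℂ) := Complex.ofRealCLM.contDiff.comp hβ
    have hβ2 : HasCompactSupport fun x => (β x : ℂ) :=
      hβ'.comp_left (g := ((↑) : ℝ → ℂ)) Complex.ofReal_zero
    -- Chosen so that the partial Fourier transform of a ⊗ β is exactly α ⊗ β.
    let a : 𝓢(ℝ, ℂ) := 𝓕⁻ (hα2.toSchwartzMap hα1)
    have hmem := tensor_mem_schwartzSlices a hβ1.continuous hβ2
    obtain ⟨p, hp1, hp2⟩ := exists_mem_shearL2_prod hmem.2.1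
      (memLp_shearAction_tensor hψ a hβ1.continuous hβ2)
    have hp := tensor_mem_closure hψ a hβ1 hβ2 hp1 hp2
    have hpg := (shearGraph ψ).topologicalClosure_minimal (shearGraph_le_multiplicationGraph hψ)
      (isClosed_multiplicationGraph (continuous_shearSymbol hψ).measurable) hp
    have h0 := hh p hp
    rw [← (shearFourier n).inner_map_map, L2.inner_def] at h0
    rw [← h0]
    refine integral_congr_ae ?_
    filter_upwards [coeFn_add_I_smul hpg, shearFourier_ae hmem hp1] with x h1 h2
    have h3 : partialFourier (fun x : ShearSpace n => a x.1 * (β x.2 : ℂ)) x =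
        (β x.2 : ℂ) * α x.1 := by
      rw [← Prod.mk.eta (p := x), partialFourier_of_slice (g := (β x.2 : ℂ) • a)
        (fun t => by rw [smul_apply, smul_eq_mul, mul_comm]), FourierTransform.fourier_smul,
        FourierTransform.fourier_fourierInv_eq]
      rfl
    rw [h1, h2, h3, RCLike.inner_apply, Complex.real_smul]
    simp only [map_mul, map_add, Complex.conj_ofReal, Complex.conj_I]
    push_cast
    ring
  rw [← map_eq_zero_iff _ (shearFourier n).injective]
  refine Lp.ext ?_
  filter_upwards [hz, Lp.coeFn_zero ℂ 2 (volume : Measure (ShearSpace n))] with x h1 h2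
  rw [h2]
  refine (mul_eq_zero.1 h1).resolve_left fun h3 => ?_
  simpa using congrArg Complex.im h3

/-- The Fourier transform in `x₁` carries the shear flow to multiplication by its symbol. -/
theorem isMultiplicationModel_shearFlow (hψ : Continuous ψ) :
    IsMultiplicationModel (shearFlow ψ) (shearFourier n) (shearSymbol ψ) := by
  refine isMultiplicationModel_closure ?_
  rw [shearMinimal_graph]
  exact topologicalClosure_eq_multiplicationGraph (continuous_shearSymbol hψ).measurable
    (shearGraph_le_multiplicationGraph hψ) fun _ => eq_zero_of_inner_closure_eq_zero hψ

end ShearCore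

/-! ### The theorem for regular shear flows. -/

theorem mainTheorem8 (n : ℕ) (ψ : EuclideanSpace ℝ (Fin n) → ℝ) (hψ : IsRegularShear ψ) :
    IsSelfAdjoint (shearFlow ψ) ∧
      ∃ E : ℝ → ShearL2 n →L[ℂ] ShearL2 n,
        IsSpectralFamily (shearFlow ψ) E ∧
          ∀ f g : ShearL2 n, ∃ μ : ComplexMeasure ℝ,
            IsSpectralMeasure E f g μ ∧
              VectorMeasure.AbsolutelyContinuous μ
                (volume : Measure ℝ).toENNRealVectorMeasure := by
  obtain ⟨l, hl, hlψ⟩ := hψ.exists_lower_bound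
  obtain ⟨L, hL⟩ := hψ.exists_lipschitz
  have hm := (continuous_shearSymbol hL.continuous).measurable
  have hA := isMultiplicationModel_shearFlow hL.continuous
  exact ⟨hA.isSelfAdjoint hm, cutoffProjection (shearFourier n) hm, hA.isSpectralFamily hm,
    exists_isSpectralMeasure_cutoffProjection _ hm
      (map_shearSymbol_absolutelyContinuous hL.continuous fun y => hl.trans (hlψ y))⟩
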